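/- **Setting.** Let $G=(V,E)$ be an undirected simple graph on $V=\{0,1,\dots,K+1\}$, $K\ge 0$ (transmitter $0$, receiver $K+1$, single-antenna half-duplex relays $1,\dots,K$). Each edge $e\in E$ carries a complex gain $h_e$; the gains are independent, circularly symmetric complex Gaussian with arbitrary positive variances, and constant during a block. A node $a$ receives $y_a=\sum_{\{a,b\}\in E}h_{\{a,b\}}x_b+n_a$ with independent noises of variance $1$; every node has power $P$. An *RS scheme* consists of paths $\mathrm p_1,\dots,\mathrm p_L$ of $G$ from $0$ to $K+1$ (repetitions allowed), of lengths $l_1,\dots,l_L$, a number $S$ of slots, and slots $s_{i,j}\in\{1,\dots,S\}$ ($1\le i\le L$, $1\le j\le l_i$) such that $s_{i,1}<s_{i',1}$ for $i<i'$; $s_{i,j}<s_{i,j'}$ for $j<j'$; $\{\mathrm p_i(j),\mathrm p_{i'}(j'-1)\}\notin E$ whenever $i<i'$ and $s_{i,j}=s_{i',j'}$; and no node receives and transmits in the same slot. The transmitter sends the $i$-th portion of a Gaussian codeword of power $P$ in slot $s_{i,1}$; for $j<l_i$, node $\mathrm p_i(j)$ multiplies what it received in slot $s_{i,j}$ by an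 independent uniform phase known to the receiver, amplifies it to power $P$, and transmits it in slot $s_{i,j+1}$; the receiver decodes from slots $s_{1,l_1},\dots,s_{L,l_L}$. If $H$ and $Q$ are the resulting end-to-end channel and noise matrices, the rate is $\frac1S\log_2\det\bigl(I+P\,HH^{\mathsf H}(QQ^{\mathsf H})^{-1}\bigr)$. The scheme is *non-interfering* if $\{\mathrm p_i(j),\mathrm p_{i'}(j'-1)\}\notin E$ whenever $i\ne i'$ and $s_{i,j}=s_{i',j'}$. The *diversity gain* at multiplexing gain $r\ge0$ is $$d_{RS,NI}(r)=-\lim_{P\to\infty}\frac{\log \Pr\{\text{rate}\le r\log_2P+c\}}{\log P},$$ for every constant $c\ge 0$, where $c>0$ if $r=0$ (so that $c=0$ gives target rate $r\log_2P$ when $r>0$, and at $r=0$ the target rate is a fixed positive number); that the limit exists and does not depend on $c$ is part of the claim. A cut-set is a set $\mathcal S\subseteq V$ with $0\in\mathcal S$, $K+1\notin\mathcal S$; its weight $w_G(\mathcal S)$ is the number of edges between $\mathcal S$ and $V\setminus\mathcal S$. Let $d_G=\min_{\mathcal S}w_G(\mathcal S)$, let $l_G$ be the maximum length of a path from $0$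 to $K+1$, and $x^+=\max\{x,0\}$. **Theorem 1.** For every non-interfering RS scheme and every $r\ge0$, the diversity gain exists and $$d_{RS,NI}(r)=\min\Bigl\{\sum_{e\in E}\mu_e\;:\;0\le\mu_e\le1\ (e\in E),\ \sum_{i=1}^L\max_{1\le j\le l_i}\mu_{\{\mathrm p_i(j-1),\mathrm p_i(j)\}}\ge L-Sr\Bigr\},$$ $$d_{RS,NI}(r)\le(1-r)^+\,d_G .$$ Moreover, there are $d_G$ pairwise edge-disjoint paths $\hat{\mathrm p}_1,\dots,\hat{\mathrm p}_{d_G}$ from $0$ to $K+1$ (a maximum flow) such that for every $L_0\ge1$ there is a non-interfering RS scheme with $L=L_0d_G$ paths, in which each $\hat{\mathrm p}_k$ occurs exactly $L_0$ times, and which satisfies for all $r\ge0$ $$d_{RS,NI}(r)\ge(1-l_G\,r)^+\,d_G .$$ -/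

import Mathlib

open MeasureTheory ProbabilityTheory Filter Topology
open scoped NNReal Matrix

noncomputable section

namespace RelayNetwork

variable {K : ℕ}

/-- The transmitter is node `0`, the receiver is node `K + 1`, and `1, …, K` are the relays.
A route is a path of the connectivity graph from the transmitter to the receiver. -/
abbrev Route (G : SimpleGraph (Fin (K + 2))) : Type :=
  G.Path (0 : Fin (K + 2)) (Fin.last (K + 1))

/-- Number of edges of a route. -/
def Route.len {G : SimpleGraph (Fin (K + 2))} (p : Route G) : ℕ := p.1.length

/-- The `j`-th node visited by a route. -/
def Route.node {G : SimpleGraph (Fin (K + 2))} (p : Route G) (j : ℕ) : Fin (K + 2) :=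
  p.1.getVert j

/-- The `j`-th edge of a route, from its `j`-th to its `(j+1)`-st node (`0 ≤ j < len`). -/
def Route.edge {G : SimpleGraph (Fin (K + 2))} (p : Route G) (j : Fin p.len) : G.edgeSet :=
  ⟨s(p.node j, p.node (j + 1)),
    (SimpleGraph.mem_edgeSet G).2 (p.1.adj_getVert_succ j.2)⟩

/-- Weight of the cut-set `A` when every node has a single antenna. -/
def cutWeight (G : SimpleGraph (Fin (K + 2))) [DecidableRel G.Adj]
    (A : Finset (Fin (K + 2))) : ℕ :=
  ∑ a ∈ A, ∑ b ∈ Aᶜ, if G.Adj a b then 1 else 0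

/-- Minimum weight of a cut-set: a set of nodes with the transmitter inside and the
receiver outside. -/
def minCut (G : SimpleGraph (Fin (K + 2))) [DecidableRel G.Adj] : ℕ :=
  sInf {w | ∃ A : Finset (Fin (K + 2)), 0 ∈ A ∧ Fin.last (K + 1) ∉ A ∧ cutWeight G A = w}

/-- Maximum length of a path from the transmitter to the receiver. -/
def maxRouteLength (G : SimpleGraph (Fin (K + 2))) : ℕ :=
  sSup {n | ∃ p : Route G, p.len = n}

/-- Path sequence and timing sequence of the random sequential (RS) scheme on a half-duplex
network. There are `L` paths and `S` slots. Hops and slots are counted from `0`: in slot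
`slot i j`, for `0 ≤ j < len`, node `j` of the `i`-th path sends to node `j + 1` of that path.
(Values `slot i j` with `j` at least the length of the path are not used.) -/
structure RSScheme (G : SimpleGraph (Fin (K + 2))) where
  /-- number of paths -/
  L : ℕ
  /-- number of slots -/
  S : ℕ
  /-- the path sequence -/
  path : Fin L → Route G
  /-- the timing sequence -/
  slot : Fin L → ℕ → Fin S
  /-- the paths are started in order -/
  ordered : ∀ i i', i < i' → slot i 0 < slot i' 0
  /-- causality -/
  causal : ∀ i j j', j < j' → j' < (path i).len → slot i j < slot i j'
  /-- no noncausal interference -/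
  noncausal : ∀ i i' j j', i < i' → j < (path i).len → j' < (path i').len →
    slot i j = slot i' j' → ¬ G.Adj ((path i).node (j + 1)) ((path i').node j')
  /-- no node receives and transmits in the same slot -/
  halfDuplex : ∀ i i' j j', j < (path i).len → j' < (path i').len →
    slot i j = slot i' j' → (path i).node (j + 1) ≠ (path i').node j'

namespace RSScheme

variable {G : SimpleGraph (Fin (K + 2))}

/-- Non-interfering relaying: there is neither causal nor noncausal interference between
signals sent over different paths. -/
def NonInterfering (R : RSScheme G) : Prop :=
  ∀ i i' j j', i ≠ i' → j < (R.path i).len → j' < (R.path i').len →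
    R.slot i j = R.slot i' j' → ¬ G.Adj ((R.path i).node (j + 1)) ((R.path i').node j')

/-- Feasible region of the linear program. -/
def region (R : RSScheme G) (r : ℝ) : Set (G.edgeSet → ℝ) :=
  {μ | (∀ e, 0 ≤ μ e ∧ μ e ≤ 1) ∧
    (R.L : ℝ) - R.S * r ≤ ∑ i : Fin R.L, ⨆ j : Fin (R.path i).len, μ ((R.path i).edge j)}

/-- For given channel gains every signal of the network is a linear combination of the `L`
codeword portions and of the noises at the nodes in the slots. It is represented by its two
vectors of coefficients. -/
abbrev Signal (R : RSScheme G) : Type :=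
  (Fin R.L → ℂ) × (Fin (K + 2) × Fin R.S → ℂ)

/-- Power of a signal: codeword symbols have power `P`, noise symbols have power `1`. -/
def power (R : RSScheme G) (P : ℝ) (z : R.Signal) : ℝ :=
  P * ∑ i, ‖z.1 i‖ ^ 2 + ∑ m, ‖z.2 m‖ ^ 2

/-- The largest amplification coefficient that meets the output power constraint `P`. -/
def amplification (R : RSScheme G) (P : ℝ) (z : R.Signal) : ℝ :=
  Real.sqrt (P / R.power P z)

variable [DecidableRel G.Adj]

/-- The signal received by node `a` in slot `s`, for channel gains `h` and rotations `φ`: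
`y_a = ∑_{b adjacent to a} h_{a,b} x_b + n_a`, where `x_b` is the sum of all that node `b`
transmits in slot `s`. On hop `0` of path `i` this is the `i`-th codeword portion; on hop
`j > 0` it is the signal which `b` received on hop `j - 1`, multiplied by the unit-modulus
scalar of `b` for that path (a `1 × 1` unitary matrix) and amplified to power `P`. -/
def received (R : RSScheme G) (P : ℝ) (h : G.edgeSet → ℂ)
    (φ : Fin R.L × Fin (K + 2) → UnitAddCircle) (s : Fin R.S) (a : Fin (K + 2)) : R.Signal :=
  (∑ b : Fin (K + 2), if hab : G.Adj a b then
    h ⟨s(a, b), (SimpleGraph.mem_edgeSet G).2 hab⟩ •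
      (∑ i : Fin R.L, ∑ j : Fin (R.path i).len,
        if _hj : R.slot i j = s ∧ (R.path i).node j = b then
          if _h0 : (j : ℕ) = 0 then ((Pi.single i 1, 0) : R.Signal)
          else
            ((AddCircle.toCircle (φ (i, b)) : ℂ) *
                (R.amplification P (R.received P h φ (R.slot i ((j : ℕ) - 1)) b) : ℂ)) •
              R.received P h φ (R.slot i ((j : ℕ) - 1)) b
        else 0)
    else 0)
  + ((0, Pi.single (a, s) 1) : R.Signal)
termination_by s
decreasing_by
  all_goals
    rw [← _hj.1]
    exact R.causal i _ _ (Nat.sub_lt (Nat.pos_of_ne_zero _h0) Nat.one_pos) j.2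

/-- The signal from which the receiver decodes the `i`-th codeword portion: the one received
on the last hop of path `i`. -/
def output (R : RSScheme G) (P : ℝ) (h : G.edgeSet → ℂ)
    (φ : Fin R.L × Fin (K + 2) → UnitAddCircle) (i : Fin R.L) : R.Signal :=
  R.received P h φ (R.slot i ((R.path i).len - 1)) (Fin.last (K + 1))

/-- End-to-end channel matrix. -/
def channelMatrix (R : RSScheme G) (P : ℝ) (h : G.edgeSet → ℂ)
    (φ : Fin R.L × Fin (K + 2) → UnitAddCircle) : Matrix (Fin R.L) (Fin R.L) ℂ :=
  Matrix.of fun i k => (R.output P h φ i).1 k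

/-- End-to-end noise matrix. -/
def noiseMatrix (R : RSScheme G) (P : ℝ) (h : G.edgeSet → ℂ)
    (φ : Fin R.L × Fin (K + 2) → UnitAddCircle) :
    Matrix (Fin R.L) (Fin (K + 2) × Fin R.S) ℂ :=
  Matrix.of fun i m => (R.output P h φ i).2 m

/-- Achievable rate in bits per symbol, `(1/S) log₂ det (I + P H Hᴴ (Q Qᴴ)⁻¹)`: the mutual
information over the end-to-end channel with Gaussian codewords of power `P`, known to the
receiver, divided by the number of slots. -/
def rate (R : RSScheme G) (P : ℝ) (h : G.edgeSet → ℂ)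
    (φ : Fin R.L × Fin (K + 2) → UnitAddCircle) : ℝ :=
  1 / (R.S : ℝ) * Real.logb 2
    (1 + (P : ℂ) • (R.channelMatrix P h φ * (R.channelMatrix P h φ)ᴴ *
      (R.noiseMatrix P h φ * (R.noiseMatrix P h φ)ᴴ)⁻¹)).det.re

end RSScheme

/-- Circularly symmetric complex Gaussian distribution with mean `0` and variance `v`. -/
def complexGaussian (v : ℝ≥0) : Measure ℂ :=
  ((gaussianReal 0 (v / 2)).prod (gaussianReal 0 (v / 2))).map fun z => (⟨z.1, z.2⟩ : ℂ)

namespace RSScheme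

variable {G : SimpleGraph (Fin (K + 2))} [DecidableRel G.Adj]

/-- Law of the independent Rayleigh-fading gains of the edges, with variances `γ`, and of the
independent uniformly distributed rotations. -/
def law (R : RSScheme G) (γ : G.edgeSet → ℝ≥0) :
    Measure ((G.edgeSet → ℂ) × (Fin R.L × Fin (K + 2) → UnitAddCircle)) :=
  (Measure.pi fun e => complexGaussian (γ e)).prod
    (Measure.pi fun _ => AddCircle.haarAddCircle)

/-- Probability that the rate of the scheme at power `P` is at most the target rate `ρ`. -/
def outage (R : RSScheme G) (γ : G.edgeSet → ℝ≥0) (P ρ : ℝ) : ℝ :=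
  (R.law γ).real {ω | R.rate P ω.1 ω.2 ≤ ρ}

/-- The scheme has diversity gain `d` at multiplexing gain `r`: the outage probability at the
target rate `r log₂ P + c` decays like `P ^ (-d)`. The constant `c ≥ 0` may be `0` if `r > 0`;
for `r = 0` the target rate is a fixed positive number. -/
def HasDiversity (R : RSScheme G) (γ : G.edgeSet → ℝ≥0) (r d : ℝ) : Prop :=
  ∀ c : ℝ, 0 ≤ c → (0 < r ∨ 0 < c) →
    (∀ᶠ P : ℝ in atTop, 0 < R.outage γ P (r * Real.logb 2 P + c)) ∧
    Tendsto (fun P : ℝ => -Real.log (R.outage γ P (r * Real.logb 2 P + c)) / Real.log P)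
      atTop (𝓝 d)

end RSScheme

end RelayNetwork

end

/-!
Without interference, a node on path `i` hears on its hop nothing but the preceding node of path
`i`. Hence the end-to-end channel matrix and the noise covariance are both diagonal
(`RSScheme.exists_rate_eq`) and the scheme is a family of `L` parallel scalar channels. Amplifying
and forwarding over a hop of signal-to-noise ratio `y` turns a ratio `x` into `x'` with
`1 + x' = (1 + x) (1 + y) / (1 + x + y)`, which is `min (1 + x) (1 + y)` up to a factor `2`. So
the rate of path `i` is, up to a bounded term, the minimum over its edges `e` of
`log₂ (1 + P ‖h e‖ ^ 2)`, whatever the rotations are.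

Write `‖h e‖ ^ 2 = P ^ (-μ e)`. As `P (‖h e‖ ^ 2 ≤ t)` is of order `t` for a Rayleigh-fading gain
(`exists_complexGaussian_bounds`), the weakness `μ` costs probability `P ^ (-∑ e, μ e)`, and outage
means that `∑ i, max_j μ (edge i j) ≥ L - S r` up to vanishing terms. The decay exponent of the
outage probability is therefore the value of the linear program:
* `RSScheme.outage_le` rounds the weakness down to a finite grid and applies the union bound; the
  slack in the constraint is absorbed by compactness (`RSScheme.exists_relaxed`);
* `RSScheme.le_outage` bounds the probability from below by the event that all gains are as weak as
  an optimal `μ` prescribes. In `RSScheme.hasDiversity`, `μ` is first moved slightly towards `1`,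
  so that the bounded terms in the rate do not matter.

The upper bound `(1 - r)⁺ d_G` comes from the feasible point `μ = (1 - r)⁺` on the edges of a
minimum cut, since `L ≤ S` and every path crosses the cut. For the lower bound, `d_G` edge-disjoint
paths exist by Menger's theorem for edges (`exists_disjoint_routes`, proved by augmenting integral
flows). The scheme that sends over them one hop at a time, with `l_G` slots for each path, has
`S = L l_G`, and its linear program is bounded below since the weakest edges of
edge-disjoint paths are distinct.
-/

noncomputable section

namespace RelayNetwork

/-! ### Integral flows and edge-disjoint paths -/

section Flow

variable {V : Type*} [DecidableEq V] {G : SimpleGraph V}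

/-- The net flow of one unit sent along a walk. -/
def walkFlow {u v : V} (p : G.Walk u v) (a b : V) : ℤ :=
  (p.darts.map SimpleGraph.Dart.toProd).count (a, b) -
    (p.darts.map SimpleGraph.Dart.toProd).count (b, a)

lemma walkFlow_skew {u v : V} (p : G.Walk u v) (a b : V) :
    walkFlow p a b = -walkFlow p b a := by
  simp [walkFlow]

lemma count_dart_le_one {u v : V} {p : G.Walk u v} (hp : p.IsPath) (a b : V) :
    (p.darts.map SimpleGraph.Dart.toProd).count (a, b) ≤ 1 := by
  refine List.nodup_iff_count_le_one.1 ?_ _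
  exact (SimpleGraph.Walk.darts_nodup_of_support_nodup hp.support_nodup).map
    SimpleGraph.Dart.toProd_injective

lemma walkFlow_le {u v : V} {p : G.Walk u v} (hp : p.IsPath) (a b : V) :
    walkFlow p a b ≤ 1 := by
  have := count_dart_le_one hp a b
  simp only [walkFlow]
  omega

lemma exists_dart_of_walkFlow_pos {u v : V} {p : G.Walk u v} {a b : V}
    (h : 0 < walkFlow p a b) : ∃ d ∈ p.darts, d.fst = a ∧ d.snd = b := by
  have : (a, b) ∈ p.darts.map SimpleGraph.Dart.toProd := by
    rw [← List.count_pos_iff]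
    simp only [walkFlow] at h
    omega
  obtain ⟨d, hd, hab⟩ := List.mem_map.1 this
  exact ⟨d, hd, congrArg Prod.fst hab, congrArg Prod.snd hab⟩

/-- Along a dart of a path the unit flow equals `1`: a path never traverses an edge twice. -/
lemma walkFlow_eq_one {u v : V} {p : G.Walk u v} (hp : p.IsPath) {d : G.Dart}
    (hd : d ∈ p.darts) : walkFlow p d.fst d.snd = 1 := by
  have h1 : 0 < (p.darts.map SimpleGraph.Dart.toProd).count (d.fst, d.snd) :=
    List.count_pos_iff.2 (List.mem_map.2 ⟨d, hd, rfl⟩)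
  have h2 := count_dart_le_one hp d.fst d.snd
  have h3 : (p.darts.map SimpleGraph.Dart.toProd).count (d.snd, d.fst) = 0 := by
    rw [List.count_eq_zero]
    intro h
    obtain ⟨d', hd', h'⟩ := List.mem_map.1 h
    have hs : d' = d.symm := SimpleGraph.Dart.ext _ _ h'
    have he : d'.edge = d.edge := by rw [hs, SimpleGraph.Dart.edge_symm]
    have hn : (p.darts.map SimpleGraph.Dart.edge).Nodup :=
      SimpleGraph.Walk.edges_nodup_of_support_nodup hp.support_nodup
    have := List.inj_on_of_nodup_map hn hd' hd he
    exact d.symm_ne (by rw [← hs, this])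
  simp only [walkFlow]
  omega

lemma exists_path_of_reflTransGen {rel : V → V → Prop} (hrel : ∀ a b, rel a b → G.Adj a b)
    {s t : V} (h : Relation.ReflTransGen rel s t) :
    ∃ p : G.Path s t, ∀ d ∈ p.1.darts, rel d.fst d.snd := by
  suffices ∃ p : G.Walk s t, ∀ d ∈ p.darts, rel d.fst d.snd by
    obtain ⟨p, hp⟩ := this
    exact ⟨p.toPath, fun d hd => hp d (p.darts_toPath_subset_darts hd)⟩
  induction h using Relation.ReflTransGen.head_induction_on with
  | refl => exact ⟨.nil, by simp⟩
  | head hab _ ih =>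
    obtain ⟨p, hp⟩ := ih
    refine ⟨.cons (hrel _ _ hab) p, ?_⟩
    simp only [SimpleGraph.Walk.darts_cons, List.mem_cons, forall_eq_or_imp]
    exact ⟨hab, hp⟩

variable [Fintype V]

lemma sum_walkFlow {u v : V} (p : G.Walk u v) (a : V) :
    ∑ b, walkFlow p a b = (if a = u then 1 else 0) - if a = v then 1 else 0 := by
  induction p with
  | nil => simp [walkFlow]
  | @cons u w v huw p ih =>
    have h1 : ∀ b, walkFlow (SimpleGraph.Walk.cons huw p) a b =
        walkFlow p a b + ((if u = a ∧ w = b then 1 else 0) - if u = b ∧ w = a then 1 else 0) := by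
      intro b
      simp only [walkFlow, SimpleGraph.Walk.darts_cons, List.map_cons, List.count_cons,
        beq_iff_eq, Prod.mk.injEq]
      push_cast
      ring
    have h2 : ∑ b, (if u = a ∧ w = b then (1 : ℤ) else 0) = if a = u then 1 else 0 := by
      by_cases h : u = a
      · simp [h]
      · simp [h, Ne.symm h]
    have h3 : ∑ b, (if u = b ∧ w = a then (1 : ℤ) else 0) = if a = w then 1 else 0 := by
      by_cases h : w = a
      · simp [h]
      · simp [h, Ne.symm h]
    simp only [h1, Finset.sum_add_distrib, Finset.sum_sub_distrib, ih, h2, h3]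
    ring

/-- Either the target is reachable by a path along `rel`, or the reachable nodes form a cut that
`rel` does not leave. -/
lemma exists_path_or_cut {rel : V → V → Prop} (hrel : ∀ a b, rel a b → G.Adj a b) (s t : V) :
    (∃ p : G.Path s t, ∀ d ∈ p.1.darts, rel d.fst d.snd) ∨
      ∃ A : Finset V, s ∈ A ∧ t ∉ A ∧ ∀ a ∈ A, ∀ b ∈ Aᶜ, ¬ rel a b := by
  classical
  by_cases h : Relation.ReflTransGen rel s t
  · exact .inl (exists_path_of_reflTransGen hrel h)
  · refine .inr ⟨Finset.univ.filter (Relation.ReflTransGen rel s), by simpa using .refl,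
      by simpa using h, ?_⟩
    intro a ha b hb hab
    simp only [Finset.mem_filter, Finset.mem_univ, true_and, Finset.mem_compl] at ha hb
    exact hb (ha.tail hab)

variable [DecidableRel G.Adj]

variable (G) in
/-- An integral flow from `s` to `t` of unit edge capacity, encoded as a skew-symmetric function:
`f a b` is the net flow from `a` to `b`. -/
structure IsUnitFlow (s t : V) (f : V → V → ℤ) : Prop where
  skew : ∀ a b, f a b = -f b a
  le_cap : ∀ a b, f a b ≤ if G.Adj a b then 1 else 0
  conserved : ∀ a, a ≠ s → a ≠ t → ∑ b, f a b = 0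

/-- The net flow through a cut equals the value of the flow. -/
lemma IsUnitFlow.sum_cut {s t : V} {f : V → V → ℤ} (hf : IsUnitFlow G s t f) {A : Finset V}
    (hs : s ∈ A) (ht : t ∉ A) : ∑ a ∈ A, ∑ b ∈ Aᶜ, f a b = ∑ b, f s b := by
  have h1 : ∑ a ∈ A, ∑ b, f a b = ∑ b, f s b := by
    refine Finset.sum_eq_single_of_mem s hs fun a ha has => ?_
    exact hf.conserved a has fun h => ht (h ▸ ha)
  have h2 : ∑ a ∈ A, ∑ b ∈ A, f a b = 0 := by
    have : ∑ a ∈ A, ∑ b ∈ A, f a b = -∑ a ∈ A, ∑ b ∈ A, f a b := by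
      conv_lhs => rw [Finset.sum_comm]
      simp only [← Finset.sum_neg_distrib]
      exact Finset.sum_congr rfl fun a _ => Finset.sum_congr rfl fun b _ => hf.skew b a
    omega
  rw [← h1]
  simp only [← Finset.sum_add_sum_compl A]
  rw [Finset.sum_add_distrib, h2, zero_add]

/-- Augmentation: a unit flow whose value is below the weight of every cut can be increased. -/
lemma IsUnitFlow.exists_augment {s t : V} {f : V → V → ℤ} (hf : IsUnitFlow G s t f) (hst : s ≠ t)
    (hcut : ∀ A : Finset V, s ∈ A → t ∉ A →
      ∑ b, f s b < ∑ a ∈ A, ∑ b ∈ Aᶜ, if G.Adj a b then (1 : ℤ) else 0) :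
    ∃ g, IsUnitFlow G s t g ∧ ∑ b, g s b = ∑ b, f s b + 1 := by
  rcases exists_path_or_cut (G := G) (rel := fun a b => G.Adj a b ∧ f a b < 1)
    (fun a b h => h.1) s t with ⟨p, hp⟩ | ⟨A, hs, ht, hA⟩
  · refine ⟨fun a b => f a b + walkFlow p.1 a b, ⟨?_, ?_, ?_⟩, ?_⟩
    · intro a b
      rw [hf.skew, walkFlow_skew]
      ring
    · intro a b
      rcases le_or_gt (walkFlow p.1 a b) 0 with h | h
      · have := hf.le_cap a b
        linarith
      · obtain ⟨d, hd, rfl, rfl⟩ := exists_dart_of_walkFlow_pos h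
        have h1 := hp d hd
        have h2 := walkFlow_le p.2 d.fst d.snd
        rw [if_pos h1.1]
        have := h1.2
        omega
    · intro a has hat
      rw [Finset.sum_add_distrib, hf.conserved a has hat, sum_walkFlow]
      simp [has, hat]
    · rw [Finset.sum_add_distrib, sum_walkFlow]
      simp [hst]
  · exfalso
    have h1 := hcut A hs ht
    rw [← hf.sum_cut hs ht] at h1
    refine absurd h1 (not_lt.2 (Finset.sum_le_sum fun a ha => Finset.sum_le_sum fun b hb => ?_))
    split_ifs with hab
    · have := hA a ha b hb
      simp only [hab, true_and, not_lt] at this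
      exact this
    · have := hf.le_cap b a
      rw [if_neg fun h => hab h.symm] at this
      rw [hf.skew]
      omega

lemma exists_unitFlow {s t : V} (hst : s ≠ t) (k : ℕ)
    (hcut : ∀ A : Finset V, s ∈ A → t ∉ A →
      (k : ℤ) ≤ ∑ a ∈ A, ∑ b ∈ Aᶜ, if G.Adj a b then (1 : ℤ) else 0) :
    ∃ f, IsUnitFlow G s t f ∧ ∑ b, f s b = k := by
  induction k with
  | zero =>
    refine ⟨fun _ _ => 0, ⟨by simp, ?_, by simp⟩, by simp⟩
    intro a b
    split_ifs <;> simp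
  | succ k ih =>
    obtain ⟨f, hf, hk⟩ := ih fun A hs ht => by
      have := hcut A hs ht
      push_cast at this
      linarith
    obtain ⟨g, hg, hgk⟩ := hf.exists_augment hst fun A hs ht => by
      have := hcut A hs ht
      push_cast at this
      linarith
    exact ⟨g, hg, by rw [hgk, hk]; push_cast; rfl⟩

/-- Decomposition of a unit flow of value `k` into `k` edge-disjoint paths. -/
lemma IsUnitFlow.exists_disjoint_paths {s t : V} (hst : s ≠ t) (k : ℕ) {f : V → V → ℤ}
    (hf : IsUnitFlow G s t f) (hk : ∑ b, f s b = k) :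
    ∃ p : Fin k → G.Path s t,
      (∀ i, ∀ d ∈ (p i).1.darts, 0 < f d.fst d.snd) ∧
      Pairwise fun i j => List.Disjoint (p i).1.edges (p j).1.edges := by
  induction k generalizing f with
  | zero => exact ⟨fun i => i.elim0, fun i => i.elim0, fun i => i.elim0⟩
  | succ k ih =>
    have hadj : ∀ a b, 0 < f a b → G.Adj a b := by
      intro a b h
      by_contra hab
      have := hf.le_cap a b
      rw [if_neg hab] at this
      omega
    rcases exists_path_or_cut (G := G) hadj s t with ⟨p, hp⟩ | ⟨A, hs, ht, hA⟩
    swap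
    · exfalso
      have h1 := hf.sum_cut hs ht
      have h2 : ∑ a ∈ A, ∑ b ∈ Aᶜ, f a b ≤ 0 :=
        Finset.sum_nonpos fun a ha => Finset.sum_nonpos fun b hb => not_lt.1 (hA a ha b hb)
      rw [hk] at h1
      push_cast at h1
      omega
    have hone : ∀ d ∈ p.1.darts, f d.fst d.snd = 1 := by
      intro d hd
      have h1 := hp d hd
      have h2 := hf.le_cap d.fst d.snd
      rw [if_pos d.adj] at h2
      omega
    have hg : IsUnitFlow G s t fun a b => f a b - walkFlow p.1 a b := by
      refine ⟨?_, ?_, ?_⟩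
      · intro a b
        rw [hf.skew, walkFlow_skew]
        ring
      · intro a b
        rcases le_or_gt (walkFlow p.1 b a) 0 with h | h
        · have := hf.le_cap a b
          rw [walkFlow_skew]
          linarith
        · obtain ⟨d, hd, rfl, rfl⟩ := exists_dart_of_walkFlow_pos h
          rw [if_pos d.adj.symm, hf.skew, hone d hd, walkFlow_skew, walkFlow_eq_one p.2 hd]
          norm_num
      · intro a has hat
        rw [Finset.sum_sub_distrib, hf.conserved a has hat, sum_walkFlow]
        simp [has, hat]
    obtain ⟨q, hq, hqd⟩ := ih hg (by
      rw [Finset.sum_sub_distrib, sum_walkFlow, hk]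
      simp [hst])
    have hvanish : ∀ d ∈ p.1.darts, f d.fst d.snd - walkFlow p.1 d.fst d.snd = 0 := by
      intro d hd
      rw [hone d hd, walkFlow_eq_one p.2 hd, sub_self]
    have hpq : ∀ i, List.Disjoint p.1.edges (q i).1.edges := by
      intro i e he he'
      obtain ⟨d, hd, rfl⟩ := List.mem_map.1 he
      obtain ⟨d', hd', hdd⟩ := List.mem_map.1 he'
      have hpos := hq i d' hd'
      have hz := hvanish d hd
      rcases SimpleGraph.dart_edge_eq_iff d' d |>.1 hdd with rfl | rfl
      · omega
      · have := hg.skew d.fst d.snd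
        simp only [SimpleGraph.Dart.symm_toProd, Prod.fst_swap, Prod.snd_swap] at hpos this
        omega
    refine ⟨Fin.cons p q, ?_, ?_⟩
    · refine Fin.cases ?_ ?_
      · simpa using hp
      · intro i d hd
        have hd' : d ∈ (q i).1.darts := by simpa using hd
        have hpos := hq i d hd'
        by_contra hle
        rcases le_or_gt (walkFlow p.1 d.snd d.fst) 0 with h | h
        · rw [walkFlow_skew] at hpos
          omega
        · obtain ⟨d'', hd'', h1, h2⟩ := exists_dart_of_walkFlow_pos h
          have h3 := hvanish d'' hd''
          rw [h1, h2] at h3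
          have := hg.skew d.fst d.snd
          omega
    · intro i j hij
      induction i using Fin.cases with
      | zero =>
        induction j using Fin.cases with
        | zero => exact absurd rfl hij
        | succ j => simpa using hpq j
      | succ i =>
        induction j using Fin.cases with
        | zero => simpa using (hpq i).symm
        | succ j => simpa using hqd fun h => hij (by rw [h])

end Flow

variable {K : ℕ}

lemma minCut_le (G : SimpleGraph (Fin (K + 2))) [DecidableRel G.Adj] {A : Finset (Fin (K + 2))}
    (h0 : 0 ∈ A) (hl : Fin.last (K + 1) ∉ A) : minCut G ≤ cutWeight G A :=
  Nat.sInf_le ⟨A, h0, hl, rfl⟩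

lemma exists_minCut (G : SimpleGraph (Fin (K + 2))) [DecidableRel G.Adj] :
    ∃ A : Finset (Fin (K + 2)), 0 ∈ A ∧ Fin.last (K + 1) ∉ A ∧ cutWeight G A = minCut G :=
  Nat.sInf_mem (s := {w | ∃ A : Finset (Fin (K + 2)), 0 ∈ A ∧ Fin.last (K + 1) ∉ A ∧
    cutWeight G A = w}) ⟨_, {0}, by simp, by simp [Fin.ext_iff], rfl⟩

/-- Menger's theorem for edges: as many edge-disjoint routes as the minimum cut weight. -/
lemma exists_disjoint_routes (G : SimpleGraph (Fin (K + 2))) [DecidableRel G.Adj] :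
    ∃ p : Fin (minCut G) → Route G,
      Pairwise fun k k' => List.Disjoint (p k).1.edges (p k').1.edges := by
  have hst : (0 : Fin (K + 2)) ≠ Fin.last (K + 1) := by simp [Fin.ext_iff]
  obtain ⟨f, hf, hk⟩ := exists_unitFlow (G := G) hst (minCut G) fun A h0 hl => by
    have := minCut_le G h0 hl
    rw [cutWeight] at this
    exact_mod_cast this
  obtain ⟨p, -, hp⟩ := hf.exists_disjoint_paths hst _ hk
  exact ⟨p, hp⟩

/-! ### End-to-end channel of a non-interfering scheme -/

lemma Route.len_pos {G : SimpleGraph (Fin (K + 2))} (p : Route G) : 0 < p.len := by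
  rw [Route.len, Nat.pos_iff_ne_zero]
  intro h
  have := SimpleGraph.Walk.eq_of_length_eq_zero h
  simp [Fin.ext_iff] at this

lemma Route.node_len {G : SimpleGraph (Fin (K + 2))} (p : Route G) :
    p.node p.len = Fin.last (K + 1) := p.1.getVert_length

lemma Route.adj_node {G : SimpleGraph (Fin (K + 2))} (p : Route G) {j : ℕ} (hj : j < p.len) :
    G.Adj (p.node j) (p.node (j + 1)) := p.1.adj_getVert_succ hj

namespace RSScheme

variable {G : SimpleGraph (Fin (K + 2))} {R : RSScheme G}

lemma slot_inj (R : RSScheme G) {i : Fin R.L} {j k : ℕ} (hj : j < (R.path i).len)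
    (hk : k < (R.path i).len) (h : R.slot i j = R.slot i k) : j = k := by
  by_contra hne
  rcases lt_or_gt_of_ne hne with h' | h'
  · exact absurd h (R.causal i j k h' hk).ne
  · exact absurd h (R.causal i k j h' hj).ne'

/-- Total power of the noise contained in a signal. -/
def noisePower (z : R.Signal) : ℝ := ∑ m, ‖z.2 m‖ ^ 2

lemma noisePower_smul_add (z : R.Signal) (c : ℂ) (m : Fin (K + 2) × Fin R.S) (hm : z.2 m = 0) :
    noisePower (c • z + ((0, Pi.single m 1) : R.Signal)) = ‖c‖ ^ 2 * noisePower z + 1 := by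
  have : ∀ m', ‖(c • z + ((0, Pi.single m 1) : R.Signal)).2 m'‖ ^ 2 =
      ‖c‖ ^ 2 * ‖z.2 m'‖ ^ 2 + if m' = m then 1 else 0 := by
    intro m'
    by_cases h : m' = m
    · subst h
      simp [hm]
    · simp [h, mul_pow]
  rw [noisePower, Finset.sum_congr rfl fun m' _ => this m', Finset.sum_add_distrib,
    ← Finset.mul_sum, noisePower]
  simp

/-- Amplify-and-forward over one more hop: if `x` is the signal-to-noise ratio so far and `y` the
one of the new hop, then the new ratio `x'` satisfies `1 + x' = (1 + x) (1 + y) / (1 + x + y)`. -/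
lemma snr_hop {x y : ℝ} (hx : 0 ≤ x) (hy : 0 ≤ y) :
    x * y / (1 + x + y) ≤ x ∧ x * y / (1 + x + y) ≤ y ∧
      min (1 + x) (1 + y) ≤ 2 * (1 + x * y / (1 + x + y)) := by
  have h : 0 < 1 + x + y := by positivity
  refine ⟨?_, ?_, ?_⟩
  · rw [div_le_iff₀ h]; nlinarith [mul_nonneg hx hy]
  · rw [div_le_iff₀ h]; nlinarith [mul_nonneg hx hy]
  · have : 2 * (1 + x * y / (1 + x + y)) = 2 * ((1 + x) * (1 + y)) / (1 + x + y) := by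
      field_simp; ring
    rw [this, le_div_iff₀ h]
    rcases le_total x y with hxy | hxy
    · rw [min_eq_left (by linarith)]; nlinarith
    · rw [min_eq_right (by linarith)]; nlinarith

variable [DecidableRel G.Adj]

/-- Without interference, what a node of path `i` receives on its hop is the transmission of the
preceding node of the same path, plus its own noise. -/
lemma received_hop (hR : R.NonInterfering) (P : ℝ) (h : G.edgeSet → ℂ)
    (φ : Fin R.L × Fin (K + 2) → UnitAddCircle) (i : Fin R.L) (j : Fin (R.path i).len) :
    R.received P h φ (R.slot i j) ((R.path i).node (j + 1)) =
      h ((R.path i).edge j) •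
        (if (j : ℕ) = 0 then ((Pi.single i 1, 0) : R.Signal)
          else
            ((AddCircle.toCircle (φ (i, (R.path i).node j)) : ℂ) *
                (R.amplification P (R.received P h φ (R.slot i ((j : ℕ) - 1))
                  ((R.path i).node j)) : ℂ)) •
              R.received P h φ (R.slot i ((j : ℕ) - 1)) ((R.path i).node j)) +
      ((0, Pi.single ((R.path i).node (j + 1), R.slot i j) 1) : R.Signal) := by
  rw [received]
  congr 1
  have hadj := ((R.path i).adj_node j.2).symm
  have key : ∀ (b : Fin (K + 2)) (i' : Fin R.L) (j' : Fin (R.path i').len),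
      G.Adj ((R.path i).node (j + 1)) b → R.slot i' j' = R.slot i j → (R.path i').node j' = b →
      i' = i ∧ (j' : ℕ) = j := by
    intro b i' j' hb hs hn
    have hi : i' = i := by
      by_contra hne
      exact hR i i' j j' (Ne.symm hne) j.2 j'.2 hs.symm (hn ▸ hb)
    subst hi
    exact ⟨rfl, R.slot_inj j'.2 j.2 hs⟩
  rw [Finset.sum_eq_single ((R.path i).node j)]
  · rw [dif_pos hadj]
    congr 1
    · congr 1
      exact Subtype.ext Sym2.eq_swap
    rw [Finset.sum_eq_single i, Finset.sum_eq_single j]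
    · rw [dif_pos ⟨rfl, rfl⟩]
      split_ifs <;> rfl
    · intro j' _ hj'
      refine dif_neg fun hc => hj' ?_
      obtain ⟨-, h'⟩ := key _ i j' hadj hc.1 hc.2
      exact Fin.ext h'
    · simp
    · intro i' _ hi'
      refine Finset.sum_eq_zero fun j' _ => dif_neg fun hc => hi' ?_
      exact (key _ i' j' hadj hc.1 hc.2).1
    · simp
  · intro b _ hb
    split_ifs with hab
    · refine smul_eq_zero_of_right _ (Finset.sum_eq_zero fun i' _ =>
        Finset.sum_eq_zero fun j' _ => dif_neg fun hc => hb ?_)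
      obtain ⟨rfl, h'⟩ := key _ i' j' hab hc.1 hc.2
      rw [← hc.2, h']
    · rfl
  · simp

/-- Form of the signal received on hop `j` of path `i`: it contains only the `i`-th codeword
portion, only the noises collected on the hops up to `j`, and its signal-to-noise ratio is that of
the weakest of these hops, up to a factor. -/
lemma exists_received_form (hR : R.NonInterfering) {P : ℝ} (hP : 0 < P) (h : G.edgeSet → ℂ)
    (φ : Fin R.L × Fin (K + 2) → UnitAddCircle) (i : Fin R.L) (j : ℕ)
    (hj : j < (R.path i).len) :
    ∃ σ : ℂ, (R.received P h φ (R.slot i j) ((R.path i).node (j + 1))).1 = Pi.single i σ ∧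
      (∀ m, (R.received P h φ (R.slot i j) ((R.path i).node (j + 1))).2 m ≠ 0 →
        ∃ k ≤ j, m = ((R.path i).node (k + 1), R.slot i k)) ∧
      0 < noisePower (R.received P h φ (R.slot i j) ((R.path i).node (j + 1))) ∧
      ∃ x : ℝ, 0 ≤ x ∧
        P * ‖σ‖ ^ 2 = x * noisePower (R.received P h φ (R.slot i j) ((R.path i).node (j + 1))) ∧
        (∀ k : Fin (R.path i).len, (k : ℕ) ≤ j → x ≤ P * ‖h ((R.path i).edge k)‖ ^ 2) ∧
        ∃ k : Fin (R.path i).len,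
          1 + P * ‖h ((R.path i).edge k)‖ ^ 2 ≤ 2 ^ j * (1 + x) := by
  induction j with
  | zero =>
    have hz := received_hop hR P h φ i ⟨0, hj⟩
    simp only [if_true] at hz
    have hn : noisePower (R.received P h φ (R.slot i 0) ((R.path i).node (0 + 1))) = 1 := by
      rw [hz]
      have := noisePower_smul_add (R := R) (Pi.single i 1, 0) (h ((R.path i).edge ⟨0, hj⟩))
        ((R.path i).node (0 + 1), R.slot i 0) rfl
      rw [this]
      simp [noisePower]
    refine ⟨h ((R.path i).edge ⟨0, hj⟩), ?_, ?_, by rw [hn]; exact one_pos,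
      P * ‖h ((R.path i).edge ⟨0, hj⟩)‖ ^ 2, by positivity, by rw [hn, mul_one], ?_,
      ⟨0, hj⟩, by simp⟩
    · rw [hz]
      ext k
      simp [Pi.single_apply]
    · intro m hm
      refine ⟨0, le_rfl, ?_⟩
      by_contra hne
      apply hm
      rw [hz]
      simp [hne]
    · intro k hk
      obtain rfl : k = ⟨0, hj⟩ := Fin.ext (Nat.le_zero.1 hk)
      exact le_rfl
  | succ j ih =>
    obtain ⟨σ, h1, h2, hN, x, hx, hxN, hle, k₀, hk₀⟩ := ih (by omega)
    have hz := received_hop hR P h φ i ⟨j + 1, hj⟩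
    simp only [Nat.add_eq_zero_iff, one_ne_zero, and_false, if_false, Nat.add_sub_cancel] at hz
    set z := R.received P h φ (R.slot i j) ((R.path i).node (j + 1)) with hzdef
    rw [← smul_assoc] at hz
    set α := R.amplification P z with hα
    set θ : ℂ := (AddCircle.toCircle (φ (i, (R.path i).node (j + 1))) : ℂ) with hθ
    have hθ1 : ‖θ‖ = 1 := Circle.norm_coe _
    set g := h ((R.path i).edge ⟨j + 1, hj⟩) with hg
    set c : ℂ := g • (θ * (α : ℂ)) with hc
    set m₀ : Fin (K + 2) × Fin R.S := ((R.path i).node (j + 1 + 1), R.slot i (j + 1)) with hm₀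
    have hpow : R.power P z = (1 + x) * noisePower z := by
      have : ∑ k, ‖z.1 k‖ ^ 2 = ‖σ‖ ^ 2 := by
        rw [h1, Finset.sum_eq_single i]
        · simp
        · intro k _ hk; simp [hk]
        · simp
      rw [power, this, hxN, ← noisePower]
      ring
    have hα2 : α ^ 2 * ((1 + x) * noisePower z) = P := by
      rw [hα, amplification, hpow, Real.sq_sqrt (by positivity)]
      field_simp
    have hc2 : ‖c‖ ^ 2 = ‖g‖ ^ 2 * α ^ 2 := by
      rw [hc, norm_smul, norm_mul, hθ1, one_mul, mul_pow, Complex.norm_real, Real.norm_eq_abs,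
        sq_abs]
    have hzm : z.2 m₀ = 0 := by
      by_contra hne
      obtain ⟨k, hk, hkm⟩ := h2 m₀ hne
      have := congrArg Prod.snd hkm
      have := R.slot_inj hj (by omega) this
      omega
    have hnew := noisePower_smul_add z c m₀ hzm
    rw [← hz] at hnew
    set y := P * ‖g‖ ^ 2 with hy
    have hy0 : 0 ≤ y := by positivity
    have hcN : ‖c‖ ^ 2 * noisePower z * (1 + x) = y := by
      rw [hc2, hy]
      calc _ = ‖g‖ ^ 2 * (α ^ 2 * ((1 + x) * noisePower z)) := by ring
        _ = _ := by rw [hα2]; ring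
    obtain ⟨hb1, hb2, hb3⟩ := snr_hop hx hy0
    refine ⟨c * σ, ?_, ?_, by rw [hnew]; positivity, x * y / (1 + x + y), by positivity, ?_, ?_, ?_⟩
    · rw [hz]
      ext k
      by_cases hk : k = i
      · subst hk
        simp [h1]
      · simp [h1, hk]
    · intro m hm
      by_cases hmm : m = m₀
      · exact ⟨j + 1, le_rfl, hmm⟩
      · rw [hz] at hm
        have : z.2 m ≠ 0 := fun h0 => hm (by simp [h0, hmm])
        obtain ⟨k, hk, hkm⟩ := h2 m this
        exact ⟨k, by omega, hkm⟩
    · rw [hnew, norm_mul, mul_pow]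
      have hcN' : ‖c‖ ^ 2 * noisePower z = y / (1 + x) := by
        rw [← hcN]; field_simp
      calc P * (‖c‖ ^ 2 * ‖σ‖ ^ 2) = ‖c‖ ^ 2 * (P * ‖σ‖ ^ 2) := by ring
        _ = x * (‖c‖ ^ 2 * noisePower z) := by rw [hxN]; ring
        _ = _ := by rw [hcN']; field_simp; ring
    · intro k hk
      rcases Nat.lt_or_ge j k with hlt | hge
      · obtain rfl : k = ⟨j + 1, hj⟩ := Fin.ext (by simp only; omega)
        exact hb2
      · exact hb1.trans (hle k hge)
    · rcases le_total (1 + x) (1 + y) with hxy | hxy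
      · rw [min_eq_left hxy] at hb3
        refine ⟨k₀, hk₀.trans ?_⟩
        rw [pow_succ, mul_assoc]
        gcongr
      · rw [min_eq_right hxy] at hb3
        refine ⟨⟨j + 1, hj⟩, hb3.trans ?_⟩
        gcongr
        exact le_self_pow₀ one_le_two (by omega)

/-- Without interference the end-to-end channel splits into `L` parallel channels, one for each
path. The signal-to-noise ratio of path `i` is that of its weakest edge, up to a factor. -/
lemma exists_rate_eq (hR : R.NonInterfering) {P : ℝ} (hP : 0 < P) (h : G.edgeSet → ℂ)
    (φ : Fin R.L × Fin (K + 2) → UnitAddCircle) :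
    ∃ x : Fin R.L → ℝ, (∀ i, 0 ≤ x i) ∧
      R.rate P h φ = 1 / (R.S : ℝ) * ∑ i, Real.logb 2 (1 + x i) ∧
      (∀ i, ∀ k : Fin (R.path i).len, x i ≤ P * ‖h ((R.path i).edge k)‖ ^ 2) ∧
      ∀ i, ∃ k : Fin (R.path i).len,
        1 + P * ‖h ((R.path i).edge k)‖ ^ 2 ≤ 2 ^ (R.path i).len * (1 + x i) := by
  have hform := fun i => exists_received_form hR hP h φ i ((R.path i).len - 1)
    (Nat.sub_lt (R.path i).len_pos one_pos)
  have hlen : ∀ i, (R.path i).len - 1 + 1 = (R.path i).len := fun i =>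
    Nat.sub_add_cancel (R.path i).len_pos
  simp only [hlen, Route.node_len] at hform
  have hout : ∀ i, R.received P h φ (R.slot i ((R.path i).len - 1)) (Fin.last (K + 1)) =
    R.output P h φ i := fun i => rfl
  simp only [hout] at hform
  choose σ h1 h2 hN x hx hxN hle k₀ hk₀ using hform
  refine ⟨x, hx, ?_, fun i k => hle i k (by have := k.2; omega), fun i => ⟨k₀ i, ?_⟩⟩
  swap
  · refine (hk₀ i).trans ?_
    have := hx i
    gcongr
    · exact one_le_two
    · omega
  have hH : R.channelMatrix P h φ = Matrix.diagonal σ := by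
    ext i k
    rw [channelMatrix, Matrix.of_apply, h1, Matrix.diagonal_apply, Pi.single_apply]
    simp only [eq_comm]
  have hQ : R.noiseMatrix P h φ * (R.noiseMatrix P h φ)ᴴ =
      Matrix.diagonal fun i => ((noisePower (R.output P h φ i) : ℝ) : ℂ) := by
    ext i k
    rw [Matrix.mul_apply, Matrix.diagonal_apply]
    simp only [noiseMatrix, Matrix.conjTranspose_apply, Matrix.of_apply]
    split_ifs with hik
    · subst hik
      rw [noisePower]
      push_cast
      refine Finset.sum_congr rfl fun m _ => ?_
      rw [Complex.star_def, Complex.mul_conj, Complex.normSq_eq_norm_sq]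
      push_cast
      rfl
    · -- a common noise would be heard by the node of path `i` from a transmitter of path `k`
      refine Finset.sum_eq_zero fun m _ => ?_
      by_contra hne
      obtain ⟨hi, hk⟩ := mul_ne_zero_iff.1 hne
      obtain ⟨a, ha, ham⟩ := h2 i m hi
      obtain ⟨b, hb, hbm⟩ := h2 k m (star_ne_zero.1 hk)
      have hab := ham.symm.trans hbm
      have hb' : b < (R.path k).len := by have := hlen k; omega
      refine hR i k a b hik (by have := hlen i; omega) hb' (congrArg Prod.snd hab) ?_
      rw [show (R.path i).node (a + 1) = (R.path k).node (b + 1) from congrArg Prod.fst hab]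
      exact ((R.path k).adj_node hb').symm
  have hdet : (1 + (P : ℂ) • (R.channelMatrix P h φ * (R.channelMatrix P h φ)ᴴ *
      (R.noiseMatrix P h φ * (R.noiseMatrix P h φ)ᴴ)⁻¹)).det.re = ∏ i, (1 + x i) := by
    have : (1 + (P : ℂ) • (R.channelMatrix P h φ * (R.channelMatrix P h φ)ᴴ *
        (R.noiseMatrix P h φ * (R.noiseMatrix P h φ)ᴴ)⁻¹)) =
        Matrix.diagonal fun i => ((1 + x i : ℝ) : ℂ) := by
      have hinv : (Matrix.diagonal fun i => ((noisePower (R.output P h φ i) : ℝ) : ℂ))⁻¹ =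
          Matrix.diagonal fun i => (((noisePower (R.output P h φ i))⁻¹ : ℝ) : ℂ) := by
        refine Matrix.inv_eq_left_inv ?_
        rw [Matrix.diagonal_mul_diagonal, ← Matrix.diagonal_one]
        congr 1
        ext i
        rw [← Complex.ofReal_mul, inv_mul_cancel₀ (hN i).ne', Complex.ofReal_one]
      rw [hQ, hinv, hH, Matrix.diagonal_conjTranspose, Matrix.diagonal_mul_diagonal,
        Matrix.diagonal_mul_diagonal, ← Matrix.diagonal_smul, ← Matrix.diagonal_one,
        Matrix.diagonal_add]
      congr 1
      ext i
      have hxi : x i = P * ‖σ i‖ ^ 2 * (noisePower (R.output P h φ i))⁻¹ := by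
        rw [hxN, mul_assoc, mul_inv_cancel₀ (hN i).ne', mul_one]
      rw [hxi]
      simp only [Pi.smul_apply, Pi.star_apply, smul_eq_mul]
      rw [Complex.star_def, Complex.mul_conj, Complex.normSq_eq_norm_sq]
      push_cast
      ring
    rw [this, Matrix.det_diagonal, ← Complex.ofReal_prod, Complex.ofReal_re]
  rw [rate, hdet, Real.logb_prod]
  intro i _
  have := hx i
  positivity

end RSScheme

/-! ### Small-ball probabilities of the channel gains -/

lemma gaussianReal_Icc_le {v : ℝ≥0} (hv : v ≠ 0) (a : ℝ) :
    gaussianReal 0 v (Set.Icc (-a) a) ≤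
      ENNReal.ofReal ((√(2 * Real.pi * v))⁻¹ * (2 * a)) := by
  rw [gaussianReal_apply _ hv]
  calc ∫⁻ x in Set.Icc (-a) a, gaussianPDF 0 v x
      ≤ ∫⁻ _ in Set.Icc (-a) a, ENNReal.ofReal (√(2 * Real.pi * v))⁻¹ := by
        refine lintegral_mono fun x => ENNReal.ofReal_le_ofReal ?_
        rw [gaussianPDFReal]
        refine mul_le_of_le_one_right (by positivity) (Real.exp_le_one_iff.2 ?_)
        rw [neg_div]
        exact neg_nonpos.2 (by positivity)
    _ = _ := by
        rw [setLIntegral_const, Real.volume_Icc, ← ENNReal.ofReal_mul (by positivity)]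
        congr 1
        ring

lemma le_gaussianReal_Icc {v : ℝ≥0} (hv : v ≠ 0) {a : ℝ} (ha : a ≤ 1) :
    ENNReal.ofReal ((√(2 * Real.pi * v))⁻¹ * Real.exp (-1 / (2 * v)) * (2 * a)) ≤
      gaussianReal 0 v (Set.Icc (-a) a) := by
  rw [gaussianReal_apply _ hv]
  calc _ = ∫⁻ _ in Set.Icc (-a) a,
        ENNReal.ofReal ((√(2 * Real.pi * v))⁻¹ * Real.exp (-1 / (2 * v))) := by
        rw [setLIntegral_const, Real.volume_Icc, ← ENNReal.ofReal_mul (by positivity)]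
        congr 1
        ring
    _ ≤ _ := by
        refine setLIntegral_mono (measurable_gaussianPDF 0 v) fun x hx =>
          ENNReal.ofReal_le_ofReal ?_
        rw [gaussianPDFReal]
        gcongr
        rw [sub_zero]
        obtain ⟨h1, h2⟩ := hx
        nlinarith

instance (v : ℝ≥0) : IsProbabilityMeasure (complexGaussian v) :=
  Measure.isProbabilityMeasure_map
    (Complex.measurableEquivRealProd.symm.measurable.aemeasurable)

lemma complexGaussian_apply (v : ℝ≥0) {s : Set ℂ} (hs : MeasurableSet s) :
    complexGaussian v s = ((gaussianReal 0 (v / 2)).prod (gaussianReal 0 (v / 2)))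
      ((fun z : ℝ × ℝ => (⟨z.1, z.2⟩ : ℂ)) ⁻¹' s) :=
  Measure.map_apply Complex.measurableEquivRealProd.symm.measurable hs

/-- The squared modulus of a Rayleigh-fading gain is at most `t` with probability of order `t`. -/
lemma exists_complexGaussian_bounds {v : ℝ≥0} (hv : 0 < v) :
    ∃ c C : ℝ, 0 < c ∧ 1 ≤ C ∧
      (∀ t, 0 ≤ t → t ≤ 1 → c * t ≤ (complexGaussian v).real {z | ‖z‖ ^ 2 ≤ t}) ∧
      ∀ t, 0 ≤ t → (complexGaussian v).real {z | ‖z‖ ^ 2 ≤ t} ≤ C * t := by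
  have hv2 : v / 2 ≠ 0 := (by positivity : 0 < v / 2).ne'
  set A : ℝ := (√(2 * Real.pi * (v / 2 : ℝ≥0)))⁻¹ with hA
  set B : ℝ := Real.exp (-1 / (2 * (v / 2 : ℝ≥0))) with hB
  have hA0 : 0 < A := by
    have : (0 : ℝ) < (v / 2 : ℝ≥0) := by exact_mod_cast (by positivity : 0 < v / 2)
    positivity
  have hB0 : 0 < B := Real.exp_pos _
  have hmeas : ∀ t : ℝ, MeasurableSet {z : ℂ | ‖z‖ ^ 2 ≤ t} := fun t =>
    measurableSet_le (by fun_prop) (by fun_prop)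
  refine ⟨2 * (A * B) ^ 2, max 1 (4 * A ^ 2), by positivity, le_max_left _ _, ?_, ?_⟩
  · intro t ht ht1
    set a := √(t / 2) with ha
    have ha2 : a ^ 2 = t / 2 := Real.sq_sqrt (by positivity)
    have ha1 : a ≤ 1 := by
      rw [ha, Real.sqrt_le_iff]
      constructor <;> linarith
    have hsub : Set.Icc (-a) a ×ˢ Set.Icc (-a) a ⊆
        (fun z : ℝ × ℝ => (⟨z.1, z.2⟩ : ℂ)) ⁻¹' {z : ℂ | ‖z‖ ^ 2 ≤ t} := by
      rintro ⟨x, y⟩ ⟨⟨hx1, hx2⟩, ⟨hy1, hy2⟩⟩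
      simp only [Set.mem_preimage, Set.mem_ofPred_eq, Complex.sq_norm, Complex.normSq_mk]
      simp only at hx1 hx2 hy1 hy2
      nlinarith
    have h1 := le_gaussianReal_Icc hv2 ha1
    have h2 := (mul_le_mul' h1 h1).trans
      ((Measure.prod_prod (μ := gaussianReal 0 (v / 2)) (ν := gaussianReal 0 (v / 2))
        (Set.Icc (-a) a) (Set.Icc (-a) a)).symm.le.trans (measure_mono hsub))
    rw [← complexGaussian_apply v (hmeas t), ← hA, ← hB, ← ENNReal.ofReal_mul (by positivity)] at h2
    have h3 := (ENNReal.ofReal_le_iff_le_toReal (measure_ne_top _ _)).1 h2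
    refine le_trans (le_of_eq ?_) h3
    have : t = 2 * a ^ 2 := by linarith
    rw [this]
    ring
  · intro t ht
    set a := √t with ha
    have ha0 : 0 ≤ a := Real.sqrt_nonneg t
    have ha2 : a ^ 2 = t := Real.sq_sqrt ht
    have hsub : (fun z : ℝ × ℝ => (⟨z.1, z.2⟩ : ℂ)) ⁻¹' {z : ℂ | ‖z‖ ^ 2 ≤ t} ⊆
        Set.Icc (-a) a ×ˢ Set.Icc (-a) a := by
      rintro ⟨x, y⟩ hxy
      simp only [Set.mem_preimage, Set.mem_ofPred_eq, Complex.sq_norm, Complex.normSq_mk] at hxy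
      refine ⟨abs_le.1 (abs_le_of_sq_le_sq ?_ ha0), abs_le.1 (abs_le_of_sq_le_sq ?_ ha0)⟩
      · simp only; nlinarith [mul_self_nonneg y]
      · simp only; nlinarith [mul_self_nonneg x]
    have h1 := gaussianReal_Icc_le hv2 a
    have h2 := (measure_mono hsub).trans ((Measure.prod_prod (μ := gaussianReal 0 (v / 2))
        (ν := gaussianReal 0 (v / 2)) (Set.Icc (-a) a) (Set.Icc (-a) a)).le.trans
        (mul_le_mul' h1 h1))
    rw [← complexGaussian_apply v (hmeas t), ← hA, ← ENNReal.ofReal_mul (by positivity)] at h2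
    have h3 := ENNReal.toReal_le_of_le_ofReal (by positivity) h2
    refine h3.trans ?_
    calc A * (2 * a) * (A * (2 * a)) = 4 * A ^ 2 * t := by rw [← ha2]; ring
      _ ≤ _ := by gcongr; exact le_max_right _ _

/-! ### The linear program -/

namespace RSScheme

variable {G : SimpleGraph (Fin (K + 2))} {R : RSScheme G}

/-- Left-hand side of the constraint of the linear program: the sum over the paths of the largest
value of `μ` on the path. -/
def pathSum (R : RSScheme G) (μ : G.edgeSet → ℝ) : ℝ :=
  ∑ i : Fin R.L, ⨆ j : Fin (R.path i).len, μ ((R.path i).edge j)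

instance (i : Fin R.L) : Nonempty (Fin (R.path i).len) := ⟨⟨0, (R.path i).len_pos⟩⟩

lemma continuous_pathSum (R : RSScheme G) : Continuous R.pathSum := by
  refine continuous_finsetSum _ fun i _ => ?_
  simp_rw [← Finset.sup'_univ_eq_ciSup]
  exact Continuous.finset_sup'_apply _ fun j _ => continuous_apply _

lemma le_iSup_edge (μ : G.edgeSet → ℝ) (i : Fin R.L) (j : Fin (R.path i).len) :
    μ ((R.path i).edge j) ≤ ⨆ j : Fin (R.path i).len, μ ((R.path i).edge j) :=
  le_ciSup (Set.finite_range fun j => μ ((R.path i).edge j)).bddAbove j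

lemma mem_region {r : ℝ} {μ : G.edgeSet → ℝ} :
    μ ∈ R.region r ↔ μ ∈ Set.Icc (0 : G.edgeSet → ℝ) 1 ∧ (R.L : ℝ) - R.S * r ≤ R.pathSum μ := by
  simp only [region, Set.mem_ofPred_eq, Set.mem_Icc, Pi.le_def, forall_and, Pi.zero_apply,
    Pi.one_apply, pathSum]

lemma pathSum_le_add (R : RSScheme G) {μ ν : G.edgeSet → ℝ} {η : ℝ} (h : ∀ e, μ e ≤ ν e + η) :
    R.pathSum μ ≤ R.pathSum ν + R.L * η := by
  have : R.pathSum ν + R.L * η =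
      ∑ i : Fin R.L, ((⨆ j : Fin (R.path i).len, ν ((R.path i).edge j)) + η) := by
    simp [pathSum, Finset.sum_add_distrib]
  rw [this]
  refine Finset.sum_le_sum fun i _ => ciSup_le fun j => (h _).trans ?_
  have := le_iSup_edge ν i j
  gcongr

/-- There are at least as many slots as paths, as the paths start in different slots. -/
lemma L_le_S (R : RSScheme G) : R.L ≤ R.S := by
  have hinj : Function.Injective fun i => R.slot i 0 := by
    have : StrictMono fun i => R.slot i 0 := fun i i' h => R.ordered i i' h
    exact this.injective
  simpa using Fintype.card_le_of_injective _ hinj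

/-- The outage condition on the sum rate of the parallel channels. It is valid without slots as
well, when the rate vanishes. -/
lemma rate_le_iff {x : Fin R.L → ℝ} {ρ : ℝ} (hρ : 0 ≤ ρ) :
    1 / (R.S : ℝ) * ∑ i, Real.logb 2 (1 + x i) ≤ ρ ↔
      ∑ i, Real.logb 2 (1 + x i) ≤ R.S * ρ := by
  rcases Nat.eq_zero_or_pos R.S with hS | hS
  · have : IsEmpty (Fin R.L) := by
      have := R.L_le_S
      rw [show R.L = 0 by omega]
      infer_instance
    simp [hS, hρ]
  · have : (0 : ℝ) < R.S := by exact_mod_cast hS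
    rw [one_div_mul_eq_div, div_le_iff₀' this]

variable [DecidableRel G.Adj]

lemma exists_isLeast (R : RSScheme G) {r : ℝ} (hr : 0 ≤ r) :
    ∃ d : ℝ, IsLeast ((fun μ : G.edgeSet → ℝ => ∑ e, μ e) '' R.region r) d := by
  have hcomp : IsCompact (R.region r) := by
    have : R.region r = Set.Icc (0 : G.edgeSet → ℝ) 1 ∩ R.pathSum ⁻¹' Set.Ici (R.L - R.S * r) := by
      ext μ
      exact mem_region
    rw [this]
    exact isCompact_Icc.inter_right (isClosed_Ici.preimage R.continuous_pathSum)
  have hne : (R.region r).Nonempty := by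
    refine ⟨1, mem_region.2 ⟨⟨zero_le_one, le_rfl⟩, ?_⟩⟩
    have : (0 : ℝ) ≤ R.S * r := by positivity
    simp [pathSum, this]
  exact (hcomp.image (by fun_prop)).exists_isLeast (hne.image _)

/-- The value of the linear program is lower semicontinuous in its right-hand side. -/
lemma exists_relaxed {r d δ : ℝ} (hδ : 0 < δ)
    (hd : IsLeast ((fun μ : G.edgeSet → ℝ => ∑ e, μ e) '' R.region r) d) :
    ∃ ε > 0, ∀ μ ∈ Set.Icc (0 : G.edgeSet → ℝ) 1, R.L - R.S * r - ε ≤ R.pathSum μ →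
      d - δ ≤ ∑ e, μ e := by
  set C : Set (G.edgeSet → ℝ) := Set.Icc 0 1 ∩ {μ | ∑ e, μ e ≤ d - δ} with hC
  have hcomp : IsCompact C :=
    isCompact_Icc.inter_right (isClosed_le (by fun_prop) continuous_const)
  rcases C.eq_empty_or_nonempty with hemp | hne
  · refine ⟨1, one_pos, fun μ hμ _ => ?_⟩
    by_contra h
    have : μ ∈ C := ⟨hμ, (not_le.1 h).le⟩
    rw [hemp] at this
    exact this
  · obtain ⟨μ₀, hμ₀, hmax⟩ := hcomp.exists_isMaxOn hne R.continuous_pathSum.continuousOn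
    have hlt : R.pathSum μ₀ < R.L - R.S * r := by
      by_contra h
      have h1 : d ≤ ∑ e, μ₀ e := hd.2 ⟨μ₀, mem_region.2 ⟨hμ₀.1, not_lt.1 h⟩, rfl⟩
      have h2 : ∑ e, μ₀ e ≤ d - δ := hμ₀.2
      linarith
    refine ⟨(R.L - R.S * r - R.pathSum μ₀) / 2, by linarith, fun μ hμ hle => ?_⟩
    by_contra h
    have h1 : R.pathSum μ ≤ R.pathSum μ₀ := hmax ⟨hμ, (not_le.1 h).le⟩
    linarith

end RSScheme

/-! ### Outage probability -/

namespace RSScheme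

variable {G : SimpleGraph (Fin (K + 2))} {R : RSScheme G}

variable [DecidableRel G.Adj]

instance (R : RSScheme G) (γ : G.edgeSet → ℝ≥0) : IsProbabilityMeasure (R.law γ) := by
  unfold law
  infer_instance

lemma law_real_gains (R : RSScheme G) (γ : G.edgeSet → ℝ≥0) (A : G.edgeSet → Set ℂ) :
    (R.law γ).real {ω | ∀ e, ω.1 e ∈ A e} = ∏ e, (complexGaussian (γ e)).real (A e) := by
  have : {ω : (G.edgeSet → ℂ) × (Fin R.L × Fin (K + 2) → UnitAddCircle) | ∀ e, ω.1 e ∈ A e} =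
      Set.univ.pi A ×ˢ Set.univ := by
    ext ω
    simp
  rw [this, law, measureReal_prod_prod, probReal_univ, mul_one, Measure.real, Measure.pi_pi,
    ENNReal.toReal_prod]
  rfl

/-- Bounding the outage probability from below by the event that every gain `e` has squared modulus
at most of order `P ^ (-μ e)`. -/
lemma le_outage (hR : R.NonInterfering) {γ : G.edgeSet → ℝ≥0} (hγ : ∀ e, 0 < γ e) {r c : ℝ}
    (hr : 0 ≤ r) (hc : 0 ≤ c) {μ : G.edgeSet → ℝ} (hμ : μ ∈ Set.Icc (0 : G.edgeSet → ℝ) 1)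
    {b : ℝ} (hb : 0 < b)
    (hμr : ∀ᶠ P : ℝ in atTop, (R.L - R.pathSum μ) * Real.logb 2 P + R.L * b ≤
      R.S * (r * Real.logb 2 P + c)) :
    ∃ B > 0, ∀ᶠ P : ℝ in atTop,
      B * P ^ (-∑ e, μ e) ≤ R.outage γ P (r * Real.logb 2 P + c) := by
  choose a A ha hA hlow hupp using fun e => exists_complexGaussian_bounds (hγ e)
  -- the constant `κ` makes `1 + κ P ^ (1 - μ e) ≤ 2 ^ b P ^ (1 - μ e)`
  set κ : ℝ := min 1 (2 ^ b - 1) with hκ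
  have hκ0 : 0 < κ := by
    have : (1 : ℝ) < 2 ^ b := Real.one_lt_rpow one_lt_two hb
    exact lt_min one_pos (by linarith)
  refine ⟨∏ e, a e * κ, Finset.prod_pos fun e _ => mul_pos (ha e) hκ0, ?_⟩
  filter_upwards [hμr, eventually_gt_atTop 1] with P hP hP1
  have hP0 : 0 < P := by linarith
  have hsub : {ω : (G.edgeSet → ℂ) × (Fin R.L × Fin (K + 2) → UnitAddCircle) |
      ∀ e, ω.1 e ∈ {z : ℂ | ‖z‖ ^ 2 ≤ κ * P ^ (-μ e)}} ⊆
      {ω | R.rate P ω.1 ω.2 ≤ r * Real.logb 2 P + c} := by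
    intro ω hω
    obtain ⟨x, hx, hrate, hle, -⟩ := exists_rate_eq hR hP0 ω.1 ω.2
    have hlog : 0 ≤ Real.logb 2 P := Real.logb_nonneg one_lt_two hP1.le
    rw [Set.mem_ofPred_eq, hrate, rate_le_iff (by positivity)]
    refine le_trans ?_ hP
    have hi : ∀ i, Real.logb 2 (1 + x i) ≤
        (1 - ⨆ j : Fin (R.path i).len, μ ((R.path i).edge j)) * Real.logb 2 P + b := by
      intro i
      obtain ⟨j, hj⟩ := exists_eq_ciSup_of_finite (f := fun j : Fin (R.path i).len =>
        μ ((R.path i).edge j))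
      rw [← hj]
      set e := (R.path i).edge j
      have h1 : x i ≤ κ * P ^ (1 - μ e) := by
        have h2 : ‖ω.1 e‖ ^ 2 ≤ κ * P ^ (-μ e) := hω e
        calc x i ≤ P * ‖ω.1 e‖ ^ 2 := hle i j
          _ ≤ P * (κ * P ^ (-μ e)) := by gcongr
          _ = κ * P ^ (1 - μ e) := by
            rw [sub_eq_add_neg, Real.rpow_add hP0, Real.rpow_one]
            ring
      have h3 : 1 ≤ P ^ (1 - μ e) :=
        Real.one_le_rpow hP1.le (by have : μ e ≤ 1 := hμ.2 e; linarith)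
      have h4 : 1 + x i ≤ P ^ (1 - μ e) * 2 ^ b := by
        have : κ ≤ 2 ^ b - 1 := min_le_right _ _
        nlinarith
      have h0 := hx i
      calc Real.logb 2 (1 + x i) ≤ Real.logb 2 (P ^ (1 - μ e) * 2 ^ b) :=
            Real.logb_le_logb_of_le one_lt_two (by positivity) h4
        _ = _ := by
          rw [Real.logb_mul (by positivity) (by positivity), Real.logb_rpow_eq_mul_logb_of_pos hP0,
            Real.logb_rpow two_pos (by norm_num)]
    refine (Finset.sum_le_sum fun i _ => hi i).trans (le_of_eq ?_)
    rw [Finset.sum_add_distrib, ← Finset.sum_mul, Finset.sum_sub_distrib, pathSum]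
    simp
  refine le_trans ?_ (measureReal_mono hsub)
  rw [law_real_gains, ← Finset.sum_neg_distrib, Real.rpow_sum_of_pos hP0, ← Finset.prod_mul_distrib]
  refine Finset.prod_le_prod (fun e _ => ?_) fun e _ => ?_
  · have := ha e
    positivity
  · rw [mul_assoc]
    refine hlow e _ (by positivity) ?_
    refine mul_le_one₀ (min_le_left _ _) (by positivity) ?_
    exact Real.rpow_le_one_of_one_le_of_nonpos hP1.le (neg_nonpos.2 (hμ.1 e))

/-- The gains of squared modulus at most `P ^ (-κ)`. At level `κ = 0` all gains are admitted, since
the weakness of a strong gain is truncated to `0`. -/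
def weakGains (P κ : ℝ) : Set ℂ := {z | κ = 0 ∨ ‖z‖ ^ 2 ≤ P ^ (-κ)}

lemma complexGaussian_weakGains_le {v : ℝ≥0} {C P κ : ℝ} (hC : 1 ≤ C) (hP : 0 < P)
    (h : ∀ t, 0 ≤ t → (complexGaussian v).real {z | ‖z‖ ^ 2 ≤ t} ≤ C * t) :
    (complexGaussian v).real (weakGains P κ) ≤ C * P ^ (-κ) := by
  by_cases hκ : κ = 0
  · simpa [weakGains, hκ] using hC
  · simpa [weakGains, hκ] using h (P ^ (-κ)) (by positivity)

/-- The exponent of weakness of the gain `z`: roughly `‖z‖ ^ 2 = P ^ (-weakness P z)`, truncated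
to `[0, 1]`. -/
def weakness (P : ℝ) (z : ℂ) : ℝ :=
  max 0 (1 - Real.logb 2 (1 + P * ‖z‖ ^ 2) / Real.logb 2 P)

lemma weakness_mem_Icc {P : ℝ} (hP : 1 < P) (z : ℂ) : weakness P z ∈ Set.Icc (0 : ℝ) 1 := by
  refine ⟨le_max_left _ _, max_le zero_le_one ?_⟩
  have h1 : 0 < Real.logb 2 P := Real.logb_pos one_lt_two hP
  have h2 : 0 ≤ Real.logb 2 (1 + P * ‖z‖ ^ 2) :=
    Real.logb_nonneg one_lt_two (le_add_of_nonneg_right (by positivity))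
  have : 0 ≤ Real.logb 2 (1 + P * ‖z‖ ^ 2) / Real.logb 2 P := by positivity
  linarith

lemma mem_weakGains {P κ : ℝ} (hP : 1 < P) (hκ : 0 ≤ κ) {z : ℂ} (h : κ ≤ weakness P z) :
    z ∈ weakGains P κ := by
  rcases hκ.eq_or_lt with rfl | hκ
  · exact .inl rfl
  refine .inr ?_
  have hP0 : 0 < P := by linarith
  have h1 : 0 < Real.logb 2 P := Real.logb_pos one_lt_two hP
  have h2 : κ ≤ 1 - Real.logb 2 (1 + P * ‖z‖ ^ 2) / Real.logb 2 P :=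
    (le_max_iff.1 h).resolve_left (not_le.2 hκ)
  have h3 : Real.logb 2 (1 + P * ‖z‖ ^ 2) ≤ (1 - κ) * Real.logb 2 P := by
    rw [← div_le_iff₀ h1]
    linarith
  rw [← Real.logb_rpow_eq_mul_logb_of_pos hP0,
    Real.logb_le_logb one_lt_two (by positivity) (by positivity)] at h3
  have h4 : P * ‖z‖ ^ 2 ≤ P * P ^ (-κ) := by
    rw [sub_eq_add_neg, Real.rpow_add hP0, Real.rpow_one] at h3
    linarith
  exact le_of_mul_le_mul_left h4 hP0

/-- In outage the weakness of the edges almost satisfies the constraint of the linear program. -/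
lemma le_pathSum_weakness (hR : R.NonInterfering) {P ρ : ℝ} (hP : 1 < P) (hρ : 0 ≤ ρ)
    {h : G.edgeSet → ℂ} {φ : Fin R.L × Fin (K + 2) → UnitAddCircle} (hout : R.rate P h φ ≤ ρ) :
    R.L - (R.S * ρ + ∑ i, ((R.path i).len : ℝ)) / Real.logb 2 P ≤
      R.pathSum fun e => weakness P (h e) := by
  have hP0 : 0 < P := by linarith
  have hlog : 0 < Real.logb 2 P := Real.logb_pos one_lt_two hP
  obtain ⟨x, hx, hrate, -, hge⟩ := exists_rate_eq hR hP0 h φ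
  rw [hrate, rate_le_iff hρ] at hout
  have hi : ∀ i, 1 - (Real.logb 2 (1 + x i) + (R.path i).len) / Real.logb 2 P ≤
      ⨆ j : Fin (R.path i).len, weakness P (h ((R.path i).edge j)) := by
    intro i
    obtain ⟨k, hk⟩ := hge i
    have hxi := hx i
    refine le_trans ?_ (le_iSup_edge (fun e => weakness P (h e)) i k)
    refine le_trans ?_ (le_max_right _ _)
    have : Real.logb 2 (1 + P * ‖h ((R.path i).edge k)‖ ^ 2) ≤
        Real.logb 2 (1 + x i) + (R.path i).len := by
      refine (Real.logb_le_logb_of_le one_lt_two (by positivity) hk).trans (le_of_eq ?_)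
      rw [Real.logb_mul (by positivity) (by positivity), Real.logb_pow,
        Real.logb_self_eq_one one_lt_two]
      ring
    gcongr
  refine le_trans ?_ (Finset.sum_le_sum fun i _ => hi i)
  rw [Finset.sum_sub_distrib, ← Finset.sum_div, Finset.sum_add_distrib]
  simp only [Finset.sum_const, Finset.card_univ, Fintype.card_fin, nsmul_eq_mul, mul_one]
  gcongr

/-- Bounding the outage probability from above: the levels of weakness are rounded down to a finite
grid, and the union bound is applied to the points of the grid. -/
lemma outage_le (hR : R.NonInterfering) {γ : G.edgeSet → ℝ≥0} (hγ : ∀ e, 0 < γ e) {r c : ℝ}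
    (hr : 0 ≤ r) (hc : 0 ≤ c) {d δ : ℝ} (hδ : 0 < δ)
    (hd : IsLeast ((fun μ : G.edgeSet → ℝ => ∑ e, μ e) '' R.region r) d) :
    ∃ B : ℝ, ∀ᶠ P : ℝ in atTop,
      R.outage γ P (r * Real.logb 2 P + c) ≤ B * P ^ (-(d - δ)) := by
  choose a A ha hA hlow hupp using fun e => exists_complexGaussian_bounds (hγ e)
  obtain ⟨ε, hε, hrel⟩ := exists_relaxed hδ hd
  obtain ⟨N, hN⟩ := exists_nat_gt (2 * R.L / ε)
  have hN0 : (0 : ℝ) < N := lt_of_le_of_lt (by positivity) hN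
  have hNε : R.L * (1 / (N : ℝ)) ≤ ε / 2 := by
    rw [div_lt_iff₀ hε] at hN
    rw [mul_one_div, div_le_iff₀ hN0]
    linarith
  set D : ℝ := R.S * c + ∑ i, ((R.path i).len : ℝ) with hD
  have hlogtop : Tendsto (fun P : ℝ => Real.logb 2 P) atTop atTop :=
    Real.tendsto_logb_atTop one_lt_two
  have hlim : Tendsto (fun P : ℝ => D / Real.logb 2 P) atTop (𝓝 0) :=
    hlogtop.const_div_atTop D
  set grid : Finset (G.edgeSet → Fin (N + 1)) :=
    Finset.univ.filter fun k => d - δ ≤ ∑ e, ((k e : ℕ) : ℝ) / N with hgrid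
  refine ⟨∑ k ∈ grid, ∏ e, A e, ?_⟩
  filter_upwards [eventually_gt_atTop 1, hlim.eventually_le_const (half_pos hε)] with P hP hPD
  have hP0 : 0 < P := by linarith
  have hlog : 0 < Real.logb 2 P := Real.logb_pos one_lt_two hP
  have hsub : {ω | R.rate P ω.1 ω.2 ≤ r * Real.logb 2 P + c} ⊆
      ⋃ k ∈ grid, {ω : (G.edgeSet → ℂ) × (Fin R.L × Fin (K + 2) → UnitAddCircle) |
        ∀ e, ω.1 e ∈ weakGains P (((k e : ℕ) : ℝ) / N)} := by
    intro ω hω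
    have h1 := le_pathSum_weakness hR hP (by positivity) hω
    have h2 : (R.S * (r * Real.logb 2 P + c) + ∑ i, ((R.path i).len : ℝ)) / Real.logb 2 P =
        R.S * r + D / Real.logb 2 P := by
      rw [hD]
      field_simp
      ring
    rw [h2] at h1
    set w : G.edgeSet → ℝ := fun e => weakness P (ω.1 e) with hw
    have hw0 : ∀ e, 0 ≤ w e := fun e => (weakness_mem_Icc hP _).1
    have hw1 : ∀ e, w e ≤ 1 := fun e => (weakness_mem_Icc hP _).2
    have hkN : ∀ e, ⌊N * w e⌋₊ < N + 1 := by
      intro e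
      have : ⌊N * w e⌋₊ ≤ N := Nat.floor_le_of_le (mul_le_of_le_one_right hN0.le (hw1 e))
      omega
    have hkle : ∀ e, (⌊N * w e⌋₊ : ℝ) / N ≤ w e := by
      intro e
      rw [div_le_iff₀' hN0]
      exact Nat.floor_le (mul_nonneg hN0.le (hw0 e))
    have hkge : ∀ e, w e ≤ (⌊N * w e⌋₊ : ℝ) / N + 1 / N := by
      intro e
      rw [← add_div, le_div_iff₀' hN0]
      exact (Nat.lt_floor_add_one _).le
    have h3 := R.pathSum_le_add hkge
    have h4 := hrel (fun e => (⌊N * w e⌋₊ : ℝ) / N)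
      ⟨fun e => by simp only [Pi.zero_apply]; positivity, fun e => (hkle e).trans (hw1 e)⟩
      (by linarith)
    simp only [Set.mem_iUnion, exists_prop]
    refine ⟨fun e => ⟨⌊N * w e⌋₊, hkN e⟩, by simpa [hgrid] using h4, fun e => ?_⟩
    exact mem_weakGains hP (by positivity) (hkle e)
  refine (measureReal_mono hsub (measure_ne_top _ _)).trans
    ((measureReal_biUnion_finset_le _ _).trans ?_)
  rw [Finset.sum_mul]
  refine Finset.sum_le_sum fun k hk => ?_
  rw [law_real_gains]
  have hA0 : ∀ e, 0 ≤ A e := fun e => zero_le_one.trans (hA e)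
  calc _ ≤ ∏ e, A e * P ^ (-(((k e : ℕ) : ℝ) / N)) :=
        Finset.prod_le_prod (fun e _ => measureReal_nonneg) fun e _ =>
          complexGaussian_weakGains_le (hA e) hP0 (hupp e)
    _ = (∏ e, A e) * P ^ (-∑ e, ((k e : ℕ) : ℝ) / N) := by
        rw [Finset.prod_mul_distrib, ← Finset.sum_neg_distrib, Real.rpow_sum_of_pos hP0]
    _ ≤ _ := by
        have hk' : d - δ ≤ ∑ e, ((k e : ℕ) : ℝ) / N := (Finset.mem_filter.1 hk).2
        have : 0 ≤ ∏ e, A e := Finset.prod_nonneg fun e _ => hA0 e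
        gcongr
        exact hP.le

end RSScheme

/-- A function that lies between powers `P ^ (-(d ± δ))`, up to factors and for every `δ > 0`, has
decay exponent `d`. -/
lemma tendsto_decay_exponent {f : ℝ → ℝ} {d : ℝ}
    (hlow : ∀ δ > 0, ∃ B > 0, ∀ᶠ P : ℝ in atTop, B * P ^ (-(d + δ)) ≤ f P)
    (hupp : ∀ δ > 0, ∃ B : ℝ, ∀ᶠ P : ℝ in atTop, f P ≤ B * P ^ (-(d - δ))) :
    (∀ᶠ P : ℝ in atTop, 0 < f P) ∧
      Tendsto (fun P => -Real.log (f P) / Real.log P) atTop (𝓝 d) := by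
  have hpos : ∀ᶠ P : ℝ in atTop, 0 < f P := by
    obtain ⟨B, hB, h⟩ := hlow 1 one_pos
    filter_upwards [h, eventually_gt_atTop 0] with P hP hP0
    exact lt_of_lt_of_le (by positivity) hP
  refine ⟨hpos, ?_⟩
  have hlim : ∀ B : ℝ, Tendsto (fun P : ℝ => Real.log B / Real.log P) atTop (𝓝 0) := fun B =>
    Real.tendsto_log_atTop.const_div_atTop _
  rw [tendsto_order]
  constructor
  · intro y hy
    obtain ⟨B, hB⟩ := hupp ((d - y) / 2) (by linarith)
    filter_upwards [hB, hpos, eventually_gt_atTop 1,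
      (hlim B).eventually_lt_const (half_pos (sub_pos.2 hy))] with P h1 h2 h3 h4
    have hP0 : 0 < P := by linarith
    have hlog : 0 < Real.log P := Real.log_pos h3
    have hB0 : 0 < B := by
      have := h2.trans_le h1
      exact pos_of_mul_pos_left this (by positivity)
    have h5 := Real.log_le_log h2 h1
    rw [Real.log_mul hB0.ne' (by positivity), Real.log_rpow hP0] at h5
    rw [div_lt_iff₀ hlog] at h4
    rw [lt_div_iff₀ hlog]
    nlinarith
  · intro y hy
    obtain ⟨B, hB0, hB⟩ := hlow ((y - d) / 2) (by linarith)
    filter_upwards [hB, hpos, eventually_gt_atTop 1,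
      (hlim B).eventually_const_lt (show -((y - d) / 2) < 0 by linarith)] with P h1 h2 h3 h4
    have hP0 : 0 < P := by linarith
    have hlog : 0 < Real.log P := Real.log_pos h3
    have h5 := Real.log_le_log (by positivity) h1
    rw [Real.log_mul hB0.ne' (by positivity), Real.log_rpow hP0] at h5
    rw [lt_div_iff₀ hlog] at h4
    rw [div_lt_iff₀ hlog]
    nlinarith

namespace RSScheme

variable {G : SimpleGraph (Fin (K + 2))} {R : RSScheme G} [DecidableRel G.Adj]

/-- The diversity gain of a non-interfering scheme is the value of the linear program. -/
lemma hasDiversity (hR : R.NonInterfering) {γ : G.edgeSet → ℝ≥0} (hγ : ∀ e, 0 < γ e) {r d : ℝ}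
    (hr : 0 ≤ r) (hd : IsLeast ((fun μ : G.edgeSet → ℝ => ∑ e, μ e) '' R.region r) d) :
    R.HasDiversity γ r d := by
  intro c hc hrc
  refine tendsto_decay_exponent (fun δ hδ => ?_) fun δ hδ => outage_le hR hγ hr hc hδ hd
  obtain ⟨μ, hμ, hμd⟩ := hd.1
  obtain ⟨⟨hμ0, hμ1⟩, hμT⟩ := mem_region.1 hμ
  -- moving the minimizer towards `1` leaves room for a bounded increase of the rate if `r > 0`
  set n : ℝ := ((Fintype.card G.edgeSet : ℕ) : ℝ) with hn
  have hn0 : 0 ≤ n := Nat.cast_nonneg _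
  set θ : ℝ := min 1 (δ / (n + 1)) with hθ
  have hθ0 : 0 < θ := lt_min one_pos (by positivity)
  have hθ1 : θ ≤ 1 := min_le_left _ _
  have hθn : θ * n ≤ δ := by
    have h1 : θ ≤ δ / (n + 1) := min_le_right _ _
    rw [le_div_iff₀ (by positivity)] at h1
    nlinarith
  set ν : G.edgeSet → ℝ := fun e => (1 - θ) * μ e + θ with hν
  have hμ0' : ∀ e, 0 ≤ μ e := hμ0
  have hμ1' : ∀ e, μ e ≤ 1 := hμ1
  have hν01 : ν ∈ Set.Icc (0 : G.edgeSet → ℝ) 1 := by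
    refine ⟨fun e => ?_, fun e => ?_⟩
    · simp only [Pi.zero_apply, hν]
      nlinarith [hμ0' e]
    · simp only [Pi.one_apply, hν]
      nlinarith [hμ1' e]
  have hνF : ∑ e, ν e ≤ d + δ := by
    have h1 : ∑ e, ν e = (1 - θ) * d + θ * n := by
      rw [hν, Finset.sum_add_distrib, ← Finset.mul_sum]
      simp only at hμd
      rw [hμd]
      simp [hn, mul_comm]
    have h2 : 0 ≤ d := by
      rw [← hμd]
      exact Finset.sum_nonneg fun e _ => hμ0' e
    nlinarith
  have hνT : R.L - R.pathSum ν ≤ (1 - θ) * (R.S * r) := by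
    have h1 : R.pathSum ν = (1 - θ) * R.pathSum μ + R.L * θ := by
      simp only [pathSum, hν, Finset.mul_sum]
      rw [show (R.L : ℝ) * θ = ∑ _i : Fin R.L, θ by simp, ← Finset.sum_add_distrib]
      refine Finset.sum_congr rfl fun i _ => ?_
      rw [← ciSup_add (Set.finite_range _).bddAbove, Real.mul_iSup_of_nonneg (by linarith)]
    rw [h1]
    nlinarith
  obtain ⟨b, hb, hev⟩ : ∃ b > 0, ∀ᶠ P : ℝ in atTop,
      (R.L - R.pathSum ν) * Real.logb 2 P + R.L * b ≤ R.S * (r * Real.logb 2 P + c) := by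
    have hLS : (R.L : ℝ) ≤ R.S := by exact_mod_cast R.L_le_S
    have hS0 : (0 : ℝ) ≤ R.S := Nat.cast_nonneg _
    have hmain : ∀ P : ℝ, 1 < P → (R.L - R.pathSum ν) * Real.logb 2 P ≤
        (1 - θ) * (R.S * r) * Real.logb 2 P := fun P hP =>
      mul_le_mul_of_nonneg_right hνT (Real.logb_pos one_lt_two hP).le
    rcases hrc with hr0 | hc0
    · refine ⟨1, one_pos, ?_⟩
      filter_upwards [eventually_gt_atTop 1,
        (Real.tendsto_logb_atTop one_lt_two).eventually_ge_atTop (1 / (θ * r))] with P hP hP2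
      rw [div_le_iff₀ (by positivity)] at hP2
      have h1 := hmain P hP
      have h2 : (R.S : ℝ) * 1 ≤ R.S * (Real.logb 2 P * (θ * r)) := by gcongr
      have h3 : 0 ≤ R.S * c := by positivity
      linarith
    · refine ⟨c, hc0, ?_⟩
      filter_upwards [eventually_gt_atTop 1] with P hP
      have h1 := hmain P hP
      have h2 : (R.L : ℝ) * c ≤ R.S * c := by gcongr
      have h3 : 0 ≤ θ * (R.S * r) * Real.logb 2 P := by
        have := (Real.logb_pos one_lt_two hP).le
        positivity
      linarith
  obtain ⟨B, hB, hP⟩ := le_outage hR hγ hr hc hν01 hb hev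
  refine ⟨B, hB, ?_⟩
  filter_upwards [hP, eventually_gt_atTop 1] with P h1 h2
  refine le_trans ?_ h1
  gcongr
  exact h2.le

end RSScheme

/-! ### The cut-set bound -/

section Cut

variable {G : SimpleGraph (Fin (K + 2))}

lemma Route.exists_edge_cross (p : Route G) {A : Finset (Fin (K + 2))} (h0 : 0 ∈ A)
    (hl : Fin.last (K + 1) ∉ A) :
    ∃ j : Fin p.len, p.node j ∈ A ∧ p.node (j + 1) ∉ A := by
  by_contra! h
  have hall : ∀ j ≤ p.len, p.node j ∈ A := by
    intro j
    induction j with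
    | zero => intro _; simpa [Route.node] using h0
    | succ j ih => intro hj; exact h ⟨j, hj⟩ (ih (by omega))
  exact hl (p.node_len ▸ hall p.len le_rfl)

variable [DecidableRel G.Adj]

lemma sum_cross_le_cutWeight (A : Finset (Fin (K + 2))) [DecidablePred fun e : G.edgeSet =>
      ∃ a ∈ A, ∃ b ∈ Aᶜ, (e : Sym2 (Fin (K + 2))) = s(a, b)] :
    ∑ e : G.edgeSet, (if ∃ a ∈ A, ∃ b ∈ Aᶜ, (e : Sym2 (Fin (K + 2))) = s(a, b) then 1 else 0) ≤
      cutWeight G A := by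
  calc _ ≤ ∑ e : G.edgeSet, ∑ a ∈ A, ∑ b ∈ Aᶜ,
        (if (e : Sym2 (Fin (K + 2))) = s(a, b) then 1 else 0) := by
        refine Finset.sum_le_sum fun e _ => ?_
        split_ifs with h
        · obtain ⟨a, ha, b, hb, hab⟩ := h
          refine le_trans ?_ (Finset.single_le_sum (fun _ _ => Nat.zero_le _) ha)
          refine le_trans ?_ (Finset.single_le_sum (fun _ _ => Nat.zero_le _) hb)
          rw [if_pos hab]
        · exact Nat.zero_le _
    _ = ∑ a ∈ A, ∑ b ∈ Aᶜ, ∑ e : G.edgeSet,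
        (if (e : Sym2 (Fin (K + 2))) = s(a, b) then 1 else 0) := by
        rw [Finset.sum_comm]
        exact Finset.sum_congr rfl fun a _ => Finset.sum_comm
    _ ≤ cutWeight G A := by
        refine Finset.sum_le_sum fun a _ => Finset.sum_le_sum fun b _ => ?_
        by_cases hab : G.Adj a b
        · rw [if_pos hab, Finset.sum_eq_single ⟨s(a, b), (SimpleGraph.mem_edgeSet G).2 hab⟩]
          · simp
          · intro e _ he
            exact if_neg fun h => he (Subtype.ext h)
          · simp
        · rw [if_neg hab]
          refine (Finset.sum_eq_zero fun e _ => if_neg fun h => hab ?_).le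
          exact (SimpleGraph.mem_edgeSet G).1 (h ▸ e.2)

/-- Weakening all the edges of a minimum cut to level `(1 - r)⁺` is feasible. -/
lemma RSScheme.le_cutSet_bound (R : RSScheme G) {r d : ℝ} (hr : 0 ≤ r)
    (hd : IsLeast ((fun μ : G.edgeSet → ℝ => ∑ e, μ e) '' R.region r) d) :
    d ≤ max (1 - r) 0 * (minCut G : ℝ) := by
  classical
  obtain ⟨A, h0, hl, hA⟩ := exists_minCut G
  set t : ℝ := max (1 - r) 0 with ht
  have ht0 : 0 ≤ t := le_max_right _ _
  have ht1 : t ≤ 1 := max_le (by linarith) zero_le_one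
  set μ : G.edgeSet → ℝ := fun e =>
    t * ((if ∃ a ∈ A, ∃ b ∈ Aᶜ, (e : Sym2 (Fin (K + 2))) = s(a, b) then 1 else 0 : ℕ) : ℝ) with hμ
  have hmem : μ ∈ R.region r := by
    refine mem_region.2 ⟨⟨fun e => ?_, fun e => ?_⟩, ?_⟩
    · simp only [Pi.zero_apply, hμ]
      positivity
    · simp only [Pi.one_apply, hμ]
      split_ifs <;> simp [ht1]
    · have hi : ∀ i : Fin R.L, t ≤ ⨆ j : Fin (R.path i).len, μ ((R.path i).edge j) := by
        intro i
        obtain ⟨j, hj, hj'⟩ := (R.path i).exists_edge_cross h0 hl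
        refine le_trans (le_of_eq ?_) (le_iSup_edge μ i j)
        have : ∃ a ∈ A, ∃ b ∈ Aᶜ,
            (((R.path i).edge j : G.edgeSet) : Sym2 (Fin (K + 2))) = s(a, b) :=
          ⟨_, hj, _, Finset.mem_compl.2 hj', rfl⟩
        simp only [hμ, if_pos this, Nat.cast_one, mul_one]
      have h1 : (R.L : ℝ) * t ≤ R.pathSum μ := by
        have := Finset.sum_le_sum fun i (_ : i ∈ Finset.univ) => hi i
        simpa [pathSum] using this
      have h2 : (R.L : ℝ) * (1 - r) ≤ R.L * t := by
        gcongr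
        exact le_max_left _ _
      have h3 : (R.L : ℝ) * r ≤ R.S * r := by
        gcongr
        exact R.L_le_S
      linarith
  refine (hd.2 ⟨μ, hmem, rfl⟩).trans ?_
  simp only [hμ]
  rw [← Finset.mul_sum, ← Nat.cast_sum, ← hA]
  gcongr
  exact sum_cross_le_cutWeight A

end Cut

/-! ### Sequential scheduling of edge-disjoint paths -/

section Sequential

variable {G : SimpleGraph (Fin (K + 2))}

lemma Route.len_le_maxRouteLength (p : Route G) : p.len ≤ maxRouteLength G := by
  refine le_csSup ⟨K + 2, ?_⟩ ⟨p, rfl⟩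
  rintro _ ⟨q, rfl⟩
  have := q.2.length_lt
  rw [Fintype.card_fin] at this
  exact this.le

lemma div_of_block {M i j : ℕ} (hM : 0 < M) : (i * M + min j (M - 1)) / M = i := by
  rw [mul_comm, Nat.mul_add_div hM, Nat.div_eq_of_lt (by omega), add_zero]

lemma block_inj {M i i' j j' : ℕ} (hj : j < M) (hj' : j' < M)
    (h : i * M + min j (M - 1) = i' * M + min j' (M - 1)) : i = i' ∧ j = j' := by
  have hi : i = i' := by
    rw [← div_of_block (i := i) (j := j) (Nat.zero_lt_of_lt hj), h,
      div_of_block (Nat.zero_lt_of_lt hj)]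
  subst hi
  exact ⟨rfl, by omega⟩

variable {n : ℕ}

/-- The scheme that runs `L₀` times through the routes `p`, with a block of `maxRouteLength G`
slots of its own for each path: only one node transmits at a time. Late (unused) hops are assigned
to the last slot of the block. -/
def sequentialScheme (p : Fin n → Route G) (L₀ : ℕ) : RSScheme G where
  L := L₀ * n
  S := L₀ * n * maxRouteLength G
  path i := p (finProdFinEquiv.symm i).2
  slot i j := ⟨i * maxRouteLength G + min j (maxRouteLength G - 1), by
    have hM : 0 < maxRouteLength G :=
      (Route.len_pos _).trans_le (p (finProdFinEquiv.symm i).2).len_le_maxRouteLength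
    calc _ < i * maxRouteLength G + maxRouteLength G := by omega
      _ = (i + 1) * maxRouteLength G := by ring
      _ ≤ _ := Nat.mul_le_mul_right _ i.2⟩
  ordered i i' h := by
    have hM : 0 < maxRouteLength G :=
      (Route.len_pos _).trans_le (p (finProdFinEquiv.symm i).2).len_le_maxRouteLength
    rw [Fin.mk_lt_mk, Nat.zero_min, add_zero, add_zero]
    exact Nat.mul_lt_mul_of_pos_right h hM
  causal i j j' h hj' := by
    have := (p (finProdFinEquiv.symm i).2).len_le_maxRouteLength
    rw [Fin.mk_lt_mk]
    omega
  noncausal i i' j j' h hj hj' hs := by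
    have := block_inj (hj.trans_le (Route.len_le_maxRouteLength _))
      (hj'.trans_le (Route.len_le_maxRouteLength _)) (Fin.mk.inj hs)
    exact absurd (Fin.ext this.1) h.ne
  halfDuplex i i' j j' hj hj' hs := by
    have := block_inj (hj.trans_le (Route.len_le_maxRouteLength _))
      (hj'.trans_le (Route.len_le_maxRouteLength _)) (Fin.mk.inj hs)
    obtain ⟨hi, rfl⟩ := this
    obtain rfl := Fin.ext hi
    exact (Route.adj_node _ hj).ne'

lemma sequentialScheme_nonInterfering (p : Fin n → Route G) (L₀ : ℕ) :
    (sequentialScheme p L₀).NonInterfering := by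
  intro i i' j j' h hj hj' hs
  have := block_inj (hj.trans_le (Route.len_le_maxRouteLength _))
    (hj'.trans_le (Route.len_le_maxRouteLength _)) (Fin.mk.inj hs)
  exact absurd (Fin.ext this.1) h

lemma Route.edge_mem (p : Route G) (j : Fin p.len) :
    (p.edge j : Sym2 (Fin (K + 2))) ∈ p.1.edges := by
  exact p.1.mk_mem_edges_iff_exists.2 ⟨j, j.2, rfl⟩

lemma injective_of_disjoint {p : Fin n → Route G}
    (hp : Pairwise fun k k' => List.Disjoint (p k).1.edges (p k').1.edges) (e : Fin n → G.edgeSet)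
    (he : ∀ k, (e k : Sym2 (Fin (K + 2))) ∈ (p k).1.edges) : Function.Injective e := by
  intro k k' h
  by_contra hne
  exact hp hne (he k) (h ▸ he k')

lemma card_sequentialScheme_path {p : Fin n → Route G}
    (hp : Pairwise fun k k' => List.Disjoint (p k).1.edges (p k').1.edges) (L₀ : ℕ) (k : Fin n) :
    Nat.card {i : Fin (sequentialScheme p L₀).L // (sequentialScheme p L₀).path i = p k} = L₀ := by
  have hinj : Function.Injective p := by
    intro k k' h
    by_contra hne
    have hd : List.Disjoint (p k).1.edges (p k').1.edges := hp hne
    rw [h] at hd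
    exact hd (Route.edge_mem _ ⟨0, (p k').len_pos⟩) (Route.edge_mem _ _)
  have e : {i : Fin (L₀ * n) // p (finProdFinEquiv.symm i).2 = p k} ≃ Fin L₀ :=
    { toFun := fun i => (finProdFinEquiv.symm i.1).1
      invFun := fun a => ⟨finProdFinEquiv (a, k), by rw [Equiv.symm_apply_apply]⟩
      left_inv := by
        rintro ⟨i, hi⟩
        refine Subtype.ext ?_
        simp only [← hinj hi, Prod.mk.eta, Equiv.apply_symm_apply]
      right_inv := fun a => by simp only [Equiv.symm_apply_apply] }
  exact (Nat.card_congr e).trans (Nat.card_fin L₀)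

variable [DecidableRel G.Adj]

/-- Every path of the sequential scheme has a weakest edge, and the weakest edges of edge-disjoint
paths are distinct. -/
lemma le_sequentialScheme_value {p : Fin n → Route G}
    (hp : Pairwise fun k k' => List.Disjoint (p k).1.edges (p k').1.edges) {L₀ : ℕ} (hL₀ : 1 ≤ L₀)
    {r d : ℝ} (hd : IsLeast ((fun μ : G.edgeSet → ℝ => ∑ e, μ e) ''
      (sequentialScheme p L₀).region r) d) :
    max (1 - (maxRouteLength G : ℝ) * r) 0 * (n : ℝ) ≤ d := by
  obtain ⟨μ, hμ, rfl⟩ := hd.1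
  obtain ⟨hμ01, hμT⟩ := RSScheme.mem_region.1 hμ
  have hne : ∀ k, Nonempty (Fin (p k).len) := fun k => ⟨⟨0, (p k).len_pos⟩⟩
  choose j hj using fun k => exists_eq_ciSup_of_finite (f := fun j : Fin (p k).len =>
    μ ((p k).edge j))
  have hinj := injective_of_disjoint hp (fun k => (p k).edge (j k)) fun k => (p k).edge_mem _
  have hle : ∑ k, μ ((p k).edge (j k)) ≤ ∑ e, μ e := by
    rw [← Finset.sum_image (s := Finset.univ) (g := fun k => (p k).edge (j k)) (f := μ)
      fun k _ k' _ h => hinj h]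
    exact Finset.sum_le_univ_sum_of_nonneg fun e => hμ01.1 e
  have hsum : (sequentialScheme p L₀).pathSum μ = L₀ * ∑ k, μ ((p k).edge (j k)) := by
    have h1 : (sequentialScheme p L₀).pathSum μ = ∑ i : Fin (L₀ * n),
        ⨆ j, μ ((p (finProdFinEquiv.symm i).2).edge j) := rfl
    rw [h1, Equiv.sum_comp finProdFinEquiv.symm fun x => ⨆ j, μ ((p x.2).edge j),
      Fintype.sum_prod_type]
    simp [← hj]
  have hL : ((sequentialScheme p L₀).L : ℝ) = L₀ * n := by simp [sequentialScheme]
  have hS : ((sequentialScheme p L₀).S : ℝ) = L₀ * n * maxRouteLength G := by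
    simp [sequentialScheme]
  rw [hsum, hL, hS] at hμT
  have hpos : (0 : ℝ) < L₀ := by exact_mod_cast hL₀
  have h2 : (1 - maxRouteLength G * r) * n ≤ ∑ k, μ ((p k).edge (j k)) := by
    refine le_of_mul_le_mul_left ?_ hpos
    linarith
  rcases max_cases (1 - (maxRouteLength G : ℝ) * r) 0 with ⟨h, -⟩ | ⟨h, -⟩
  · rw [h]
    exact h2.trans hle
  · rw [h, zero_mul]
    exact Finset.sum_nonneg fun e _ => hμ01.1 e

end Sequential

end RelayNetwork

end

open RelayNetwork in
theorem theorem1 (K : ℕ) (G : SimpleGraph (Fin (K + 2))) [DecidableRel G.Adj] :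
    (∀ R : RSScheme G, R.NonInterfering →
      ∀ γ : G.edgeSet → ℝ≥0, (∀ e, 0 < γ e) → ∀ r : ℝ, 0 ≤ r →
        ∃ d : ℝ, R.HasDiversity γ r d ∧
          IsLeast ((fun μ : G.edgeSet → ℝ => ∑ e, μ e) '' R.region r) d ∧
          d ≤ max (1 - r) 0 * (minCut G : ℝ)) ∧
    (∃ p : Fin (minCut G) → Route G,
      (Pairwise fun k k' => List.Disjoint (p k).1.edges (p k').1.edges) ∧
      ∀ L₀ : ℕ, 1 ≤ L₀ → ∃ R : RSScheme G, R.NonInterfering ∧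
        R.L = L₀ * minCut G ∧
        (∀ k, Nat.card {i : Fin R.L // R.path i = p k} = L₀) ∧
        ∀ γ : G.edgeSet → ℝ≥0, (∀ e, 0 < γ e) → ∀ r : ℝ, 0 ≤ r →
          ∃ d : ℝ, R.HasDiversity γ r d ∧
            max (1 - (maxRouteLength G : ℝ) * r) 0 * (minCut G : ℝ) ≤ d) := by
  refine ⟨fun R hR γ hγ r hr => ?_, ?_⟩
  · obtain ⟨d, hd⟩ := R.exists_isLeast hr
    exact ⟨d, RSScheme.hasDiversity hR hγ hr hd, hd, R.le_cutSet_bound hr hd⟩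
  · obtain ⟨p, hp⟩ := exists_disjoint_routes G
    refine ⟨p, hp, fun L₀ hL₀ => ⟨sequentialScheme p L₀, sequentialScheme_nonInterfering p L₀, rfl,
      card_sequentialScheme_path hp L₀, fun γ hγ r hr => ?_⟩⟩
    obtain ⟨d, hd⟩ := (sequentialScheme p L₀).exists_isLeast hr
    exact ⟨d, RSScheme.hasDiversity (sequentialScheme_nonInterfering p L₀) hγ hr hd,
      le_sequentialScheme_value hp hL₀ hd⟩
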